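/- Let $k$ be a field and $G$ a finite abelian group such that the characteristic of $k$ does not divide $|G|$, and let $\widehat G=\mathrm{Hom}(G,k^\times)$. For a $k$-algebra $A$ on which $G$ acts by $k$-algebra automorphisms, the skew group algebra $AG$ is $A\otimes_k kG$ with product $(a\otimes g)(b\otimes h)=a\,g(b)\otimes gh$; the group $\widehat G$ acts on $AG$ by algebra automorphisms through $\chi(a\otimes g)=\chi(g)a\otimes g$. Let $\Lambda$ be a finite dimensional $k$-algebra on which $G$ acts by $k$-algebra automorphisms, and let $D^b(\Lambda)$ be the bounded derived category of finitely generated right $\Lambda$-modules. For $g\in G$ put $X^g=X\otimes^{\mathbf L}_\Lambda\Lambda_g$ and $f^g=f\otimes^{\mathbf L}1_{\Lambda_g}$, where $\Lambda_g$ is $\Lambda$ as a left module, with right action $y*\lambda=y\,g(\lambda)$; identify $(X^{g})^{h}=X^{gh}$ canonically. Let $X\in D^b(\Lambda)$ be a $G$-invariant object, that is, an object with isomorphisms $\iota_g:X^{g^{-1}}\to X$ $(g\in G)$ such that $\iota_{gh}=\iota_g\circ(\iota_h)^{g^{-1}}$ for all $g,h\in G$. Then $G$ acts on the algebra $\mathrm{End}_{D^b(\Lambda)}(X)$,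 whose product is composition, by $g.f=\iota_g\circ f^{g^{-1}}\circ\iota_g^{-1}$. The object $X\otimes^{\mathbf L}_\Lambda\Lambda G$ of $D^b(\Lambda G)$ is a $\widehat G$-invariant object through the isomorphisms $\iota_\chi:(X\otimes^{\mathbf L}_\Lambda\Lambda G)^{\chi^{-1}}\to X\otimes^{\mathbf L}_\Lambda\Lambda G$ induced by $x\otimes g\mapsto\chi(g)\,x\otimes g$, so that $\widehat G$ acts on its endomorphism algebra by $\chi.f=\iota_\chi\circ f^{\chi^{-1}}\circ\iota_\chi^{-1}$. Then there is an isomorphism of $k$-algebras $$\mathrm{End}_{D^b(\Lambda)}(X)\,G\;\cong\;\mathrm{End}_{D^b(\Lambda G)}(X\otimes^{\mathbf L}_\Lambda\Lambda G)$$ that commutes with the actions of $\widehat G$. -/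

import Mathlib

universe u

noncomputable section

open CategoryTheory Category Limits DerivedCategory

namespace GAlg

/-! ## Exact functors between bounded derived categories -/

section Bounded

variable {C₁ C₂ C₃ C₄ : Type*} [Category* C₁] [Category* C₂] [Category* C₃] [Category* C₄]
  [Abelian C₁] [Abelian C₂] [Abelian C₃] [Abelian C₄]
  [HasDerivedCategory C₁] [HasDerivedCategory C₂] [HasDerivedCategory C₃] [HasDerivedCategory C₄]

section Obj

variable (F : C₁ ⥤ C₂) [F.Additive] [PreservesFiniteLimits F] [PreservesFiniteColimits F]

theorem bounded_mapDerivedCategory (X : DerivedCategory C₁)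
    (hX : (TStructure.t (C := C₁)).bounded X) :
    (TStructure.t (C := C₂)).bounded (F.mapDerivedCategory.obj X) := by
  obtain ⟨⟨a, ⟨K, e, _⟩⟩, ⟨b, ⟨L, e', _⟩⟩⟩ := hX
  refine ⟨⟨a, ⟨(F.mapHomologicalComplex _).obj K,
    F.mapDerivedCategory.mapIso e ≪≫ F.mapDerivedCategoryFactors.app K, inferInstance⟩⟩,
    ⟨b, ⟨(F.mapHomologicalComplex _).obj L,
    F.mapDerivedCategory.mapIso e' ≪≫ F.mapDerivedCategoryFactors.app L, inferInstance⟩⟩⟩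

/-- The functor between bounded derived categories given by an exact functor, applied to complexes
degree by degree. -/
def mapBounded : Bounded C₁ ⥤ Bounded C₂ :=
  ObjectProperty.lift _ (Bounded.ι ⋙ F.mapDerivedCategory)
    (fun X ↦ bounded_mapDerivedCategory F X.obj X.property)

instance : (mapBounded F).Additive where
  map_add {X Y f g} := by
    ext
    exact F.mapDerivedCategory.map_add

instance (R : Type*) [Ring R] [Linear R C₁] [Linear R C₂] [F.Linear R] :
    (mapBounded F).Linear R where
  map_smul f r := by
    ext
    exact F.mapDerivedCategory.map_smul r f.hom

/-- The functor on derived categories given by an exact functor `F` is the total left derived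
functor of `F`. -/
theorem isLeftDerivedFunctor_mapDerivedCategory :
    F.mapDerivedCategory.IsLeftDerivedFunctor F.mapDerivedCategoryFactors.hom
      (HomologicalComplex.quasiIso C₁ (ComplexShape.up ℤ)) :=
  Functor.isLeftDerivedFunctor_of_inverts _ _ F.mapDerivedCategoryFactors

end Obj

section Trans

variable {F F' F'' : C₁ ⥤ C₂} [F.Additive] [PreservesFiniteLimits F] [PreservesFiniteColimits F]
  [F'.Additive] [PreservesFiniteLimits F'] [PreservesFiniteColimits F']
  [F''.Additive] [PreservesFiniteLimits F''] [PreservesFiniteColimits F'']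

/-- The natural transformation on derived categories induced by a natural transformation between
exact functors. -/
def derivedTrans (τ : F ⟶ F') : F.mapDerivedCategory ⟶ F'.mapDerivedCategory :=
  Localization.liftNatTrans Q (HomologicalComplex.quasiIso C₁ (ComplexShape.up ℤ))
    (F.mapHomologicalComplex _ ⋙ Q) (F'.mapHomologicalComplex _ ⋙ Q) _ _
    (Functor.whiskerRight (NatTrans.mapHomologicalComplex τ _) Q)

theorem derivedTrans_app (τ : F ⟶ F') (K : CochainComplex C₁ ℤ) :
    (derivedTrans τ).app (Q.obj K) = F.mapDerivedCategoryFactors.hom.app K ≫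
      Q.map ((NatTrans.mapHomologicalComplex τ _).app K) ≫
        F'.mapDerivedCategoryFactors.inv.app K :=
  Localization.liftNatTrans_app ..

theorem derivedTrans_id : derivedTrans (𝟙 F) = 𝟙 _ := by
  refine Localization.natTrans_ext Q (HomologicalComplex.quasiIso C₁ (ComplexShape.up ℤ)) ?_
  intro K
  simp [derivedTrans_app]

theorem derivedTrans_comp (τ : F ⟶ F') (σ : F' ⟶ F'') :
    derivedTrans (τ ≫ σ) = derivedTrans τ ≫ derivedTrans σ := by
  refine Localization.natTrans_ext Q (HomologicalComplex.quasiIso C₁ (ComplexShape.up ℤ)) ?_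
  intro K
  simp [derivedTrans_app]

/-- The natural isomorphism on bounded derived categories induced by a natural isomorphism between
exact functors. -/
def boundedIso (e : F ≅ F') : mapBounded F ≅ mapBounded F' where
  hom := { app X := ⟨(derivedTrans e.hom).app X.obj⟩
           naturality _ _ f := by ext; exact (derivedTrans e.hom).naturality f.hom }
  inv := { app X := ⟨(derivedTrans e.inv).app X.obj⟩
           naturality _ _ f := by ext; exact (derivedTrans e.inv).naturality f.hom }
  hom_inv_id := by
    ext X
    change (derivedTrans e.hom).app X.obj ≫ (derivedTrans e.inv).app X.obj = 𝟙 _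
    rw [← NatTrans.comp_app, ← derivedTrans_comp, e.hom_inv_id, derivedTrans_id]; rfl
  inv_hom_id := by
    ext X
    change (derivedTrans e.inv).app X.obj ≫ (derivedTrans e.hom).app X.obj = 𝟙 _
    rw [← NatTrans.comp_app, ← derivedTrans_comp, e.inv_hom_id, derivedTrans_id]; rfl

end Trans

section Comp

variable (F : C₁ ⥤ C₂) [F.Additive] [PreservesFiniteLimits F] [PreservesFiniteColimits F]
  (H : C₂ ⥤ C₃) [H.Additive] [PreservesFiniteLimits H] [PreservesFiniteColimits H]

instance : PreservesFiniteLimits (F ⋙ H) := comp_preservesFiniteLimits F H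

instance : PreservesFiniteColimits (F ⋙ H) := comp_preservesFiniteColimits F H

/-- Passing to derived categories is compatible with composition of exact functors. -/
def derivedComp : (F ⋙ H).mapDerivedCategory ≅ F.mapDerivedCategory ⋙ H.mapDerivedCategory :=
  letI : Localization.Lifting Q (HomologicalComplex.quasiIso C₁ (ComplexShape.up ℤ))
      ((F ⋙ H).mapHomologicalComplex _ ⋙ Q) (F.mapDerivedCategory ⋙ H.mapDerivedCategory) :=
    ⟨(Functor.associator _ _ _).symm ≪≫
      Functor.isoWhiskerRight F.mapDerivedCategoryFactors _ ≪≫ Functor.associator _ _ _ ≪≫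
      Functor.isoWhiskerLeft _ H.mapDerivedCategoryFactors⟩
  Localization.liftNatIso Q (HomologicalComplex.quasiIso C₁ (ComplexShape.up ℤ))
    ((F ⋙ H).mapHomologicalComplex _ ⋙ Q) ((F ⋙ H).mapHomologicalComplex _ ⋙ Q) _ _ (Iso.refl _)

theorem derivedComp_hom_app (K : CochainComplex C₁ ℤ) :
    (derivedComp F H).hom.app (Q.obj K) = (F ⋙ H).mapDerivedCategoryFactors.hom.app K ≫
      H.mapDerivedCategoryFactors.inv.app ((F.mapHomologicalComplex _).obj K) ≫
        H.mapDerivedCategory.map (F.mapDerivedCategoryFactors.inv.app K) := by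
  let this : Localization.Lifting Q (HomologicalComplex.quasiIso C₁ (ComplexShape.up ℤ))
      ((F ⋙ H).mapHomologicalComplex _ ⋙ Q) (F.mapDerivedCategory ⋙ H.mapDerivedCategory) :=
    ⟨(Functor.associator _ _ _).symm ≪≫
      Functor.isoWhiskerRight F.mapDerivedCategoryFactors _ ≪≫ Functor.associator _ _ _ ≪≫
      Functor.isoWhiskerLeft _ H.mapDerivedCategoryFactors⟩
  refine (Localization.liftNatTrans_app Q (HomologicalComplex.quasiIso C₁ (ComplexShape.up ℤ))
    ((F ⋙ H).mapHomologicalComplex _ ⋙ Q) ((F ⋙ H).mapHomologicalComplex _ ⋙ Q) _ _ _ K).trans ?_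
  simp only [Functor.comp_obj, Iso.refl_hom, NatTrans.id_app]
  erw [Category.id_comp]
  refine congrArg ((F ⋙ H).mapDerivedCategoryFactors.hom.app K ≫ ·) ?_
  simp
  refine congrArg (· ≫ H.mapDerivedCategory.map (F.mapDerivedCategoryFactors.inv.app K)) ?_
  exact Category.comp_id _

/-- Passing to bounded derived categories is compatible with composition of exact functors. -/
def boundedComp : mapBounded (F ⋙ H) ≅ mapBounded F ⋙ mapBounded H where
  hom := { app X := ⟨(derivedComp F H).hom.app X.obj⟩
           naturality _ _ f := by ext; exact (derivedComp F H).hom.naturality f.hom }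
  inv := { app X := ⟨(derivedComp F H).inv.app X.obj⟩
           naturality _ _ f := by ext; exact (derivedComp F H).inv.naturality f.hom }
  hom_inv_id := by
    ext X
    exact (derivedComp F H).hom_inv_id_app X.obj
  inv_hom_id := by
    ext X
    exact (derivedComp F H).inv_hom_id_app X.obj

end Comp

variable (C₁) in
/-- The identity functor induces the identity on derived categories. -/
def derivedId : (𝟭 C₁).mapDerivedCategory ≅ 𝟭 (DerivedCategory C₁) :=
  letI : Localization.Lifting Q (HomologicalComplex.quasiIso C₁ (ComplexShape.up ℤ))
      ((𝟭 C₁).mapHomologicalComplex _ ⋙ Q) (𝟭 (DerivedCategory C₁)) :=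
    ⟨Q.rightUnitor ≪≫ Q.leftUnitor.symm ≪≫
      Functor.isoWhiskerRight (Functor.mapHomologicalComplexIdIso C₁ _).symm Q⟩
  Localization.liftNatIso Q (HomologicalComplex.quasiIso C₁ (ComplexShape.up ℤ))
    ((𝟭 C₁).mapHomologicalComplex _ ⋙ Q) ((𝟭 C₁).mapHomologicalComplex _ ⋙ Q) _ _ (Iso.refl _)

variable (C₁) in
/-- The identity functor induces the identity on bounded derived categories. -/
def boundedId : mapBounded (𝟭 C₁) ≅ 𝟭 (Bounded C₁) where
  hom := { app X := ⟨(derivedId C₁).hom.app X.obj⟩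
           naturality _ _ f := by ext; exact (derivedId C₁).hom.naturality f.hom }
  inv := { app X := ⟨(derivedId C₁).inv.app X.obj⟩
           naturality _ _ f := by ext; exact (derivedId C₁).inv.naturality f.hom }
  hom_inv_id := by
    ext X
    exact (derivedId C₁).hom_inv_id_app X.obj
  inv_hom_id := by
    ext X
    exact (derivedId C₁).inv_hom_id_app X.obj

section Coherence

theorem coherence_aux₁ {D D' : Type*} [Category* D] [Category* D'] (E : D ⥤ D')
    {a a' b b' : D} {c c' z z' : D'} (f : a ≅ b) (f' : a' ≅ b') (t : b ⟶ b')
    (h : E.obj b ≅ c) (h' : E.obj b' ≅ c') (s : c ⟶ c') (hs : s ≫ h'.inv = h.inv ≫ E.map t)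
    (p : z ≅ c) (p' : z' ≅ c') :
    (p.hom ≫ s ≫ p'.inv) ≫ p'.hom ≫ h'.inv ≫ E.map f'.inv =
      (p.hom ≫ h.inv ≫ E.map f.inv) ≫ E.map (f.hom ≫ t ≫ f'.inv) := by
  simp only [assoc, Iso.inv_hom_id_assoc, ← Functor.map_comp]
  rw [reassoc_of% hs, ← Functor.map_comp]

theorem coherence_aux₂ {D D' : Type*} [Category* D] [Category* D'] (E E' : D ⥤ D') (σ : E ⟶ E')
    {a b : D} {c c' z z' : D'} (f : a ≅ b) (h : E.obj b ≅ c) (h' : E'.obj b ≅ c') (s : c ⟶ c')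
    (hs : σ.app b = h.hom ≫ s ≫ h'.inv) (p : z ≅ c) (p' : z' ≅ c') :
    (p.hom ≫ s ≫ p'.inv) ≫ p'.hom ≫ h'.inv ≫ E'.map f.inv =
      (p.hom ≫ h.inv ≫ E.map f.inv) ≫ σ.app a := by
  simp [hs]

theorem coherence_aux₃ {D D' D'' : Type*} [Category* D] [Category* D'] [Category* D'']
    (E : D ⥤ D') (E' : D' ⥤ D'') (I : D ⥤ D'') (σ : I ⟶ E ⋙ E')
    {a b : D} {c z : D'} {d y y' : D''} (f : a ≅ b) (h : E.obj b ≅ c) (k : E'.obj c ≅ d)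
    (q : I.obj b ≅ d) (hq : σ.app b = q.hom ≫ k.inv ≫ E'.map h.inv) (r : z ≅ c)
    (p : y ≅ d) (p' : y' ≅ d) (s : d ⟶ d) (hs : s = 𝟙 d) :
    (p.hom ≫ s ≫ p'.inv) ≫ (p'.hom ≫ q.inv ≫ I.map f.inv) ≫ σ.app a =
      (p.hom ≫ k.inv ≫ E'.map r.inv) ≫ E'.map (r.hom ≫ h.inv ≫ E.map f.inv) := by
  simp [hs, hq]

theorem coherence_aux₄ {D D' : Type*} [Category* D] [Category* D'] (E : D ⥤ D')
    {w x y z n o : D'} {d e e' : D} (v : w ≅ x) (m' : w ⟶ y) (u : y ⟶ z) (m : x ⟶ z)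
    (h₁ : m' ≫ u = v.hom ≫ m) (s : n ⟶ y) (s' : y ⟶ n) (hs : s' ≫ s = 𝟙 y)
    (t : d ≅ e) (c : z ⟶ E.obj e) (q : n ⟶ E.obj d)
    (h₂ : s ≫ u ≫ c = q ≫ E.map t.hom) {x' : D'} (r : x' ≅ E.obj e') (a' : n ⟶ x')
    (a : d ⟶ e') (h₃ : a' ≫ r.hom = q ≫ E.map a) (b : x' ⟶ o) (f : w ⟶ o)
    (hf : f = m' ≫ s' ≫ a' ≫ b) :
    v.inv ≫ f = (m ≫ c) ≫ E.map (t.inv ≫ a) ≫ r.inv ≫ b := by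
  have h₄ : v.hom ≫ m ≫ c = m' ≫ s' ≫ q ≫ E.map t.hom := by
    rw [← h₂, ← reassoc_of% h₁, reassoc_of% hs]
  have h₅ : E.map t.hom ≫ E.map t.inv = 𝟙 _ := by
    rw [← E.map_comp, t.hom_inv_id, E.map_id]
  rw [Iso.inv_comp_eq, hf, assoc, reassoc_of% h₄, E.map_comp, assoc, reassoc_of% h₅,
    ← reassoc_of% h₃, Iso.hom_inv_id_assoc]

variable {F F' : C₁ ⥤ C₂} [F.Additive] [PreservesFiniteLimits F] [PreservesFiniteColimits F]
  [F'.Additive] [PreservesFiniteLimits F'] [PreservesFiniteColimits F']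
  {H H' : C₂ ⥤ C₃} [H.Additive] [PreservesFiniteLimits H] [PreservesFiniteColimits H]
  [H'.Additive] [PreservesFiniteLimits H'] [PreservesFiniteColimits H']
  {P : C₃ ⥤ C₄} [P.Additive] [PreservesFiniteLimits P] [PreservesFiniteColimits P]

theorem derivedComp_whiskerRight (τ : F ⟶ F') (X : DerivedCategory C₁) :
    (derivedTrans (Functor.whiskerRight τ H)).app X ≫ (derivedComp F' H).hom.app X =
      (derivedComp F H).hom.app X ≫ H.mapDerivedCategory.map ((derivedTrans τ).app X) := by
  have := Localization.natTrans_ext Q (HomologicalComplex.quasiIso C₁ (ComplexShape.up ℤ))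
    (τ := derivedTrans (Functor.whiskerRight τ H) ≫ (derivedComp F' H).hom)
    (τ' := (derivedComp F H).hom ≫ Functor.whiskerRight (derivedTrans τ) H.mapDerivedCategory) ?_
  · exact congr_app this X
  intro K
  refine (congrArg₂ (· ≫ ·) (derivedTrans_app _ K) (derivedComp_hom_app _ _ K)).trans
    (Eq.trans ?_ (congrArg₂ (· ≫ ·) (derivedComp_hom_app _ _ K)
      (congrArg H.mapDerivedCategory.map (derivedTrans_app τ K))).symm)
  exact coherence_aux₁ H.mapDerivedCategory (F.mapDerivedCategoryFactors.app K)
    (F'.mapDerivedCategoryFactors.app K) (Q.map ((NatTrans.mapHomologicalComplex τ _).app K))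
    (H.mapDerivedCategoryFactors.app _) (H.mapDerivedCategoryFactors.app _) _
    (H.mapDerivedCategoryFactors.inv.naturality ((NatTrans.mapHomologicalComplex τ _).app K))
    ((F ⋙ H).mapDerivedCategoryFactors.app K) ((F' ⋙ H).mapDerivedCategoryFactors.app K)

theorem derivedComp_whiskerLeft (σ : H ⟶ H') (X : DerivedCategory C₁) :
    (derivedTrans (Functor.whiskerLeft F σ)).app X ≫ (derivedComp F H').hom.app X =
      (derivedComp F H).hom.app X ≫ (derivedTrans σ).app (F.mapDerivedCategory.obj X) := by
  have := Localization.natTrans_ext Q (HomologicalComplex.quasiIso C₁ (ComplexShape.up ℤ))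
    (τ := derivedTrans (Functor.whiskerLeft F σ) ≫ (derivedComp F H').hom)
    (τ' := (derivedComp F H).hom ≫ Functor.whiskerLeft F.mapDerivedCategory (derivedTrans σ)) ?_
  · exact congr_app this X
  intro K
  refine (congrArg₂ (· ≫ ·) (derivedTrans_app _ K) (derivedComp_hom_app _ _ K)).trans
    (Eq.trans ?_ (congrArg (· ≫ (derivedTrans σ).app (F.mapDerivedCategory.obj (Q.obj K)))
      (derivedComp_hom_app F H K)).symm)
  exact coherence_aux₂ _ _ (derivedTrans σ) (F.mapDerivedCategoryFactors.app K)
    (H.mapDerivedCategoryFactors.app _) (H'.mapDerivedCategoryFactors.app _) _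
    (derivedTrans_app σ _)
    ((F ⋙ H).mapDerivedCategoryFactors.app K) ((F ⋙ H').mapDerivedCategoryFactors.app K)

theorem derivedComp_assoc (X : DerivedCategory C₁) :
    (derivedTrans (Functor.associator F H P).hom).app X ≫ (derivedComp F (H ⋙ P)).hom.app X ≫
        (derivedComp H P).hom.app (F.mapDerivedCategory.obj X) =
      (derivedComp (F ⋙ H) P).hom.app X ≫
        P.mapDerivedCategory.map ((derivedComp F H).hom.app X) := by
  have := Localization.natTrans_ext Q (HomologicalComplex.quasiIso C₁ (ComplexShape.up ℤ))
    (τ := derivedTrans (Functor.associator F H P).hom ≫ (derivedComp F (H ⋙ P)).hom ≫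
      Functor.whiskerLeft F.mapDerivedCategory (derivedComp H P).hom)
    (τ' := (derivedComp (F ⋙ H) P).hom ≫
      Functor.whiskerRight (derivedComp F H).hom P.mapDerivedCategory) ?_
  · exact congr_app this X
  intro K
  refine (congrArg₂ (· ≫ ·) (derivedTrans_app _ K)
    (congrArg (· ≫ (derivedComp H P).hom.app (F.mapDerivedCategory.obj (Q.obj K)))
      (derivedComp_hom_app F (H ⋙ P) K))).trans
    (Eq.trans ?_ (congrArg₂ (· ≫ ·) (derivedComp_hom_app _ _ K)
      (congrArg P.mapDerivedCategory.map (derivedComp_hom_app F H K))).symm)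
  exact coherence_aux₃ _ _ _ (derivedComp H P).hom (F.mapDerivedCategoryFactors.app K)
    (H.mapDerivedCategoryFactors.app _) (P.mapDerivedCategoryFactors.app _)
    ((H ⋙ P).mapDerivedCategoryFactors.app _) (derivedComp_hom_app H P _)
    ((F ⋙ H).mapDerivedCategoryFactors.app K)
    (((F ⋙ H) ⋙ P).mapDerivedCategoryFactors.app K)
    ((F ⋙ H ⋙ P).mapDerivedCategoryFactors.app K) _ (Q.map_id _)

theorem derivedComp_cocycle {T T' W : C₂ ⥤ C₂} [T.Additive] [PreservesFiniteLimits T]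
    [PreservesFiniteColimits T] [T'.Additive] [PreservesFiniteLimits T']
    [PreservesFiniteColimits T'] [W.Additive] [PreservesFiniteLimits W] [PreservesFiniteColimits W]
    (m : W ⟶ T ⋙ T') (a : F ⋙ T ⟶ F) (b : F ⋙ T' ⟶ F) (c : F ⋙ W ⟶ F)
    (hc : c = Functor.whiskerLeft F m ≫ (Functor.associator F T T').inv ≫
      Functor.whiskerRight a T' ≫ b) (X : DerivedCategory C₁) :
    (derivedComp F W).inv.app X ≫ (derivedTrans c).app X =
      ((derivedTrans m).app (F.mapDerivedCategory.obj X) ≫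
        (derivedComp T T').hom.app (F.mapDerivedCategory.obj X)) ≫
      T'.mapDerivedCategory.map ((derivedComp F T).inv.app X ≫ (derivedTrans a).app X) ≫
      (derivedComp F T').inv.app X ≫ (derivedTrans b).app X := by
  refine coherence_aux₄ T'.mapDerivedCategory ((derivedComp F W).app X)
    ((derivedTrans (Functor.whiskerLeft F m)).app X) ((derivedComp F (T ⋙ T')).hom.app X)
    ((derivedTrans m).app (F.mapDerivedCategory.obj X)) (derivedComp_whiskerLeft m X)
    ((derivedTrans (Functor.associator F T T').hom).app X)
    ((derivedTrans (Functor.associator F T T').inv).app X) ?_ ((derivedComp F T).app X) _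
    ((derivedComp (F ⋙ T) T').hom.app X) (derivedComp_assoc X) ((derivedComp F T').app X)
    ((derivedTrans (Functor.whiskerRight a T')).app X) _ (derivedComp_whiskerRight a X) _ _ ?_
  · refine (congr_app (derivedTrans_comp (Functor.associator F T T').inv
      (Functor.associator F T T').hom).symm X).trans ?_
    rw [Iso.inv_hom_id, derivedTrans_id]
    rfl
  · rw [hc, derivedTrans_comp, derivedTrans_comp, derivedTrans_comp]
    rfl

end Coherence

end Bounded

/-! ## Finitely generated right modules over a finite dimensional algebra -/

section Modules

variable (k : Type u) [Field k] (Λ : Type u) [Ring Λ] [Algebra k Λ]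

/-- The category `mod Λ` of finitely generated right modules over the `k`-algebra `Λ`. A right
`Λ`-module is a module over `Λᵐᵒᵖ`, and `MulOpposite.op a • m` stands for `m a`. -/
def FMod (k : Type u) [Field k] (Λ : Type u) [Ring Λ] [Algebra k Λ] : Type (u + 1) :=
  FGModuleCat.{u} Λᵐᵒᵖ

instance : Category.{u} (FMod k Λ) := inferInstanceAs (Category (FGModuleCat.{u} Λᵐᵒᵖ))

/-- The underlying type of a finitely generated right module. -/
def FMod.carrier {k : Type u} [Field k] {Λ : Type u} [Ring Λ] [Algebra k Λ] (M : FMod k Λ) :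
    Type u :=
  FGModuleCat.carrier (R := Λᵐᵒᵖ) M

instance : CoeSort (FMod k Λ) (Type u) := ⟨FMod.carrier⟩

instance instAddCommGroupFMod (M : FMod k Λ) : AddCommGroup M :=
  inferInstanceAs (AddCommGroup (FGModuleCat.carrier (R := Λᵐᵒᵖ) M))

instance instModuleFMod (M : FMod k Λ) : Module Λᵐᵒᵖ M :=
  inferInstanceAs (Module Λᵐᵒᵖ (FGModuleCat.carrier (R := Λᵐᵒᵖ) M))

instance instFiniteFMod (M : FMod k Λ) : Module.Finite Λᵐᵒᵖ M :=
  ObjectProperty.FullSubcategory.property (P := ModuleCat.isFG.{u} Λᵐᵒᵖ) M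

theorem isNoetherianRing_op (k : Type u) [Field k] (Λ : Type u) [Ring Λ] [Algebra k Λ]
    [Module.Finite k Λ] : IsNoetherianRing Λᵐᵒᵖ :=
  haveI : Module.Finite k Λᵐᵒᵖ := Module.Finite.equiv (MulOpposite.opLinearEquiv k)
  IsNoetherianRing.of_finite k Λᵐᵒᵖ

instance [Module.Finite k Λ] : Abelian (FMod k Λ) :=
  haveI := isNoetherianRing_op k Λ
  inferInstanceAs (Abelian (FGModuleCat.{u} Λᵐᵒᵖ))

instance [Module.Finite k Λ] : Linear k (FMod k Λ) :=
  inferInstanceAs (Linear k (FGModuleCat.{u} Λᵐᵒᵖ))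

instance [Module.Finite k Λ] : HasDerivedCategory (FMod k Λ) := HasDerivedCategory.standard _

/-- The bounded derived category of `mod Λ`. -/
abbrev Db [Module.Finite k Λ] : Type (u + 1) := DerivedCategory.Bounded (FMod k Λ)

variable {k Λ}

/-- The linear map underlying a morphism of `mod Λ`. -/
def FMod.lin {M N : FMod k Λ} (f : M ⟶ N) : M →ₗ[Λᵐᵒᵖ] N :=
  ((forget₂ (FGModuleCat.{u} Λᵐᵒᵖ) (ModuleCat.{u} Λᵐᵒᵖ)).map f).hom

/-- A finitely generated right `Λ`-module, as an object of `mod Λ`. -/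
def FMod.of (k : Type u) [Field k] {Λ : Type u} [Ring Λ] [Algebra k Λ] (M : Type u)
    [AddCommGroup M] [Module Λᵐᵒᵖ M] [Module.Finite Λᵐᵒᵖ M] : FMod k Λ :=
  FGModuleCat.of Λᵐᵒᵖ M

/-- A linear map, as a morphism of `mod Λ`. -/
def FMod.hom {M N : FMod k Λ} (f : M →ₗ[Λᵐᵒᵖ] N) : M ⟶ N :=
  (⟨ModuleCat.ofHom f⟩ : @Quiver.Hom (FGModuleCat.{u} Λᵐᵒᵖ) _ M N)

theorem FMod.lin_comp {M N P : FMod k Λ} (f : M ⟶ N) (g : N ⟶ P) :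
    FMod.lin (f ≫ g) = (FMod.lin g).comp (FMod.lin f) := rfl

theorem FMod.ext {M N : FMod k Λ} {f g : M ⟶ N} (h : ∀ x, FMod.lin f x = FMod.lin g x) :
    f = g :=
  FGModuleCat.hom_ext (R := Λᵐᵒᵖ) (LinearMap.ext h)

theorem FMod.lin_smul [Module.Finite k Λ] {M N : FMod k Λ} (r : k) (f : M ⟶ N) (x : M) :
    FMod.lin (r • f) x = MulOpposite.op (algebraMap k Λ r) • FMod.lin f x := rfl

theorem FMod.exact_iff [Module.Finite k Λ] (S : ShortComplex (FMod k Λ)) :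
    S.Exact ↔ Function.Exact (FMod.lin S.f) (FMod.lin S.g) := by
  have := isNoetherianRing_op k Λ
  let T : ShortComplex (FGModuleCat.{u} Λᵐᵒᵖ) := S
  exact (ShortComplex.exact_map_iff_of_faithful T
    (forget₂ (FGModuleCat.{u} Λᵐᵒᵖ) (ModuleCat.{u} Λᵐᵒᵖ))).symm.trans
    (ShortComplex.ShortExact.moduleCat_exact_iff_function_exact _)

/-- A functor between module categories that sends exact sequences to exact sequences preserves
finite limits and finite colimits. -/
theorem FMod.preserves {Λ' : Type u} [Ring Λ'] [Algebra k Λ'] [Module.Finite k Λ]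
    [Module.Finite k Λ'] (F : FMod k Λ ⥤ FMod k Λ') [F.Additive]
    (h : ∀ {M N P : FMod k Λ} (f : M ⟶ N) (g : N ⟶ P),
      Function.Exact (FMod.lin f) (FMod.lin g) →
        Function.Exact (FMod.lin (F.map f)) (FMod.lin (F.map g))) :
    PreservesFiniteLimits F ∧ PreservesFiniteColimits F := by
  refine ((Functor.exact_tfae F).out 1 3).1 fun S hS ↦ ?_
  rw [FMod.exact_iff] at hS ⊢
  exact h _ _ hS

end Modules

/-! ## The twist of a module by a group element -/

section Twist

variable (k : Type u) [Field k] {Λ : Type u} [Ring Λ] [Algebra k Λ]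
  {G : Type u} [Group G] [MulSemiringAction G Λ]

/-- The carrier of the twist `M ⊗_Λ Λ_g` of a right module `M`. As `Λ_g` is `Λ` as a left module
with right action `y * a = y (g a)`, the module `M ⊗_Λ Λ_g` is `M` with the right action
`m * a = m (g a)`. -/
@[nolint unusedArguments]
def TwistMod (_ : G) (M : Type u) : Type u := M

instance (g : G) (M : Type u) [AddCommGroup M] : AddCommGroup (TwistMod g M) :=
  inferInstanceAs (AddCommGroup M)

instance (g : G) (M : Type u) [AddCommGroup M] [Module Λᵐᵒᵖ M] : Module Λᵐᵒᵖ (TwistMod g M) :=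
  Module.compHom M (MulSemiringAction.toRingHom G Λ g).op

instance (g : G) (M : Type u) [AddCommGroup M] [Module Λᵐᵒᵖ M] [Module.Finite Λᵐᵒᵖ M] :
    Module.Finite Λᵐᵒᵖ (TwistMod g M) := by
  obtain ⟨s, hs⟩ := (inferInstance : Module.Finite Λᵐᵒᵖ M)
  refine ⟨s, ?_⟩
  rw [eq_top_iff]
  rintro (x : M) -
  have hx : x ∈ Submodule.span Λᵐᵒᵖ (s : Set M) := hs ▸ Submodule.mem_top
  change x ∈ Submodule.span Λᵐᵒᵖ (show Set (TwistMod g M) from (s : Set M))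
  induction hx using Submodule.span_induction with
  | mem y hy => exact Submodule.subset_span hy
  | zero => exact Submodule.zero_mem _
  | add y z _ _ hy hz => exact Submodule.add_mem _ hy hz
  | smul a y _ hy =>
    have := Submodule.smul_mem (Submodule.span Λᵐᵒᵖ (show Set (TwistMod g M) from (s : Set M)))
      (MulOpposite.op (g⁻¹ • a.unop)) hy
    have e : MulOpposite.op (g • g⁻¹ • a.unop) • y = a • y :=
      congrArg (fun b : Λ ↦ MulOpposite.op b • y) (smul_inv_smul g a.unop)
    rw [← e]
    exact this

variable (Λ) in
/-- The functor `M ↦ M^g = M ⊗_Λ Λ_g` on `mod Λ`. -/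
def twist (g : G) : FMod k Λ ⥤ FMod k Λ where
  obj M := FMod.of k (TwistMod g M)
  map {M N} f := FMod.hom (M := FMod.of k (TwistMod g M)) (N := FMod.of k (TwistMod g N))
    { toFun := fun x ↦ FMod.lin f x
      map_add' := (FMod.lin f).map_add
      map_smul' := fun a x ↦ (FMod.lin f).map_smul (MulOpposite.op (g • a.unop)) x }
  map_id _ := FMod.ext fun _ ↦ rfl
  map_comp _ _ := FMod.ext fun _ ↦ rfl

section

variable [Module.Finite k Λ]

instance (g : G) : (twist k Λ g).Additive where
  map_add := FMod.ext fun _ ↦ rfl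

instance [SMulCommClass G k Λ] (g : G) : (twist k Λ g).Linear k where
  map_smul {M N} f r := FMod.ext fun x ↦ by
    refine (FMod.lin_smul r f x).trans (Eq.symm ((FMod.lin_smul r ((twist k Λ g).map f) x).trans ?_))
    exact congrArg (fun b : Λ ↦ MulOpposite.op b • FMod.lin f x) (smul_algebraMap g r)

instance (g : G) : PreservesFiniteLimits (twist k Λ g) :=
  (FMod.preserves _ fun _ _ h ↦ h).1

instance (g : G) : PreservesFiniteColimits (twist k Λ g) :=
  (FMod.preserves _ fun _ _ h ↦ h).2

end

/-- The canonical identification `M^l = (M^g)^h` for `l = g h`; it is the identity on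
elements. -/
def TwistMod.mulEquiv {g h l : G} (e : g * h = l) (M : Type u) [AddCommGroup M] [Module Λᵐᵒᵖ M] :
    TwistMod l M ≃ₗ[Λᵐᵒᵖ] TwistMod h (TwistMod g M) where
  toFun x := x
  invFun x := x
  map_add' _ _ := rfl
  left_inv _ := rfl
  right_inv _ := rfl
  map_smul' a x := by
    subst e
    exact congrArg (fun b : Λ ↦ MulOpposite.op b • (show M from x)) (mul_smul g h a.unop)

/-- The canonical identification `M^1 = M`; it is the identity on elements. -/
def TwistMod.oneEquiv (G : Type u) [Group G] [MulSemiringAction G Λ] (M : Type u)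
    [AddCommGroup M] [Module Λᵐᵒᵖ M] : TwistMod (1 : G) M ≃ₗ[Λᵐᵒᵖ] M where
  toFun x := x
  invFun x := x
  map_add' _ _ := rfl
  left_inv _ := rfl
  right_inv _ := rfl
  map_smul' a x :=
    congrArg (fun b : Λ ↦ MulOpposite.op b • (show M from x)) (one_smul G a.unop)

/-- A linear bijection, as an isomorphism of `mod Λ`. -/
def FMod.iso {M N : FMod k Λ} (e : M ≃ₗ[Λᵐᵒᵖ] N) : M ≅ N where
  hom := FMod.hom e.toLinearMap
  inv := FMod.hom e.symm.toLinearMap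
  hom_inv_id := FMod.ext e.symm_apply_apply
  inv_hom_id := FMod.ext e.apply_symm_apply

/-- The canonical identification `M^l = (M^g)^h` for `l = g h`, as an isomorphism of modules. -/
def twistMulApp {g h l : G} (e : g * h = l) (M : FMod k Λ) :
    (twist k Λ l).obj M ≅ (twist k Λ h).obj ((twist k Λ g).obj M) :=
  FMod.iso k (M := FMod.of k (Λ := Λ) (TwistMod l M))
    (N := FMod.of k (Λ := Λ) (TwistMod h (TwistMod g M)))
    (TwistMod.mulEquiv e M)

theorem twistMulApp_naturality {g h l : G} (e : g * h = l) {M N : FMod k Λ} (f : M ⟶ N) :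
    (twist k Λ l).map f ≫ (twistMulApp k e N).hom =
      (twistMulApp k e M).hom ≫ (twist k Λ g ⋙ twist k Λ h).map f := by
  refine FMod.ext fun x ↦ ?_
  rw [FMod.lin_comp, FMod.lin_comp]
  rfl

/-- The canonical identification `M^l = (M^g)^h` for `l = g h`, as an isomorphism of functors. -/
def twistMul {g h l : G} (e : g * h = l) :
    twist k Λ l ≅ twist k Λ g ⋙ twist k Λ h :=
  NatIso.ofComponents (fun M ↦ twistMulApp k e M) fun f ↦ twistMulApp_naturality k e f

variable (G Λ) in
/-- The canonical identification `M^1 = M`, as an isomorphism of functors. -/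
def twistOne : twist k Λ (1 : G) ≅ 𝟭 (FMod k Λ) :=
  NatIso.ofComponents (fun M ↦ FMod.iso k (M := (twist k Λ (1 : G)).obj M) (N := M)
    (TwistMod.oneEquiv G M)) fun _ ↦ FMod.ext fun _ ↦ rfl

end Twist

/-! ## Extension of scalars of right modules -/

section Tensor

open TensorProduct MulOpposite

theorem zsmul_balanced {B M : Type u} [Ring B] [AddCommGroup M] {P : Type*} [AddCommGroup P] (f : M →+ B →+ P) (n : ℤ) (b : B) (m : M) :
    f.flip (n • b) m = f.flip b (n • m) := by
  rw [map_zsmul, map_zsmul]; rfl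

variable {A B : Type u} [Ring A] [Ring B] (φ : A →+* B)

section Carrier

variable (M : Type u) [AddCommGroup M] [Module Aᵐᵒᵖ M]

/-- The relations `(m a) ⊗ b = m ⊗ (φ(a) b)` of the tensor product `M ⊗_A B` of a right
`A`-module `M` with the `A`-`B`-bimodule `B`. The element `m ⊗ b` is written `b ⊗ₜ m`, and
`B` acts on the right on the factor `B`. -/
def tensorRel : Submodule Bᵐᵒᵖ (B ⊗[ℤ] M) :=
  Submodule.span Bᵐᵒᵖ
    {x | ∃ (m : M) (a : A) (b : B), x = b ⊗ₜ[ℤ] (op a • m) - (φ a * b) ⊗ₜ[ℤ] m}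

/-- The right `B`-module `M ⊗_A B`, where `B` is an `A`-module through the ring homomorphism
`φ : A → B`. -/
def TensorMod : Type u := (B ⊗[ℤ] M) ⧸ tensorRel φ M

instance : AddCommGroup (TensorMod φ M) :=
  inferInstanceAs (AddCommGroup ((B ⊗[ℤ] M) ⧸ tensorRel φ M))

instance : Module Bᵐᵒᵖ (TensorMod φ M) :=
  inferInstanceAs (Module Bᵐᵒᵖ ((B ⊗[ℤ] M) ⧸ tensorRel φ M))

variable {M}

/-- The element `m ⊗ b` of `M ⊗_A B`. -/
def TensorMod.mk (m : M) (b : B) : TensorMod φ M :=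
  (tensorRel φ M).mkQ (b ⊗ₜ[ℤ] m)

theorem TensorMod.op_smul_mk (m : M) (b c : B) :
    op c • TensorMod.mk φ m b = TensorMod.mk φ m (b * c) := rfl

theorem TensorMod.mk_smul (m : M) (a : A) (b : B) :
    TensorMod.mk φ (op a • m) b = TensorMod.mk φ m (φ a * b) :=
  (Submodule.Quotient.eq _).2 (Submodule.subset_span ⟨m, a, b, rfl⟩)

theorem TensorMod.mk_add_left (m m' : M) (b : B) :
    TensorMod.mk φ (m + m') b = TensorMod.mk φ m b + TensorMod.mk φ m' b :=
  (congrArg (tensorRel φ M).mkQ (TensorProduct.tmul_add b m m')).trans (map_add _ _ _)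

theorem TensorMod.mk_add_right (m : M) (b b' : B) :
    TensorMod.mk φ m (b + b') = TensorMod.mk φ m b + TensorMod.mk φ m b' :=
  (congrArg (tensorRel φ M).mkQ (TensorProduct.add_tmul b b' m)).trans (map_add _ _ _)

theorem TensorMod.mk_zero_left (b : B) : TensorMod.mk φ (0 : M) b = 0 :=
  (congrArg (tensorRel φ M).mkQ (TensorProduct.tmul_zero M b)).trans (map_zero _)

theorem TensorMod.induction {p : TensorMod φ M → Prop} (h0 : p 0)
    (h1 : ∀ m b, p (TensorMod.mk φ m b)) (h2 : ∀ x y, p x → p y → p (x + y)) (x) : p x := by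
  obtain ⟨y, rfl⟩ := Submodule.mkQ_surjective (tensorRel φ M) x
  induction y using TensorProduct.induction_on with
  | zero => exact h0
  | tmul b m => exact h1 m b
  | add y z hy hz => rw [map_add]; exact h2 _ _ hy hz

/-- The universal property of `M ⊗_A B`: additive maps out of it are balanced biadditive maps. -/
def TensorMod.lift {P : Type*} [AddCommGroup P] (f : M →+ B →+ P)
    (hf : ∀ m a b, f (op a • m) b = f m (φ a * b)) : TensorMod φ M →+ P :=
  QuotientAddGroup.lift (tensorRel φ M).toAddSubgroup
    (TensorProduct.liftAddHom f.flip (zsmul_balanced f))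
    (by
      intro x hx
      have key : ∀ c : B, TensorProduct.liftAddHom (R := ℤ) f.flip (zsmul_balanced f)
          (op c • x) = 0 := by
        change x ∈ tensorRel φ M at hx
        induction hx using Submodule.span_induction with
        | mem x hx =>
          obtain ⟨m, a, b, rfl⟩ := hx
          intro c
          simp [smul_sub, TensorProduct.smul_tmul', hf, mul_assoc]
        | zero => simp
        | add x y _ _ hx hy => intro c; rw [smul_add, map_add, hx, hy, add_zero]
        | smul d x _ hx =>
          intro c
          have := hx (d.unop * c)
          rwa [op_mul, mul_smul, op_unop] at this
      simpa using key 1)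

theorem TensorMod.lift_mk {P : Type*} [AddCommGroup P] (f : M →+ B →+ P)
    (hf : ∀ m a b, f (op a • m) b = f m (φ a * b)) (m : M) (b : B) :
    TensorMod.lift φ f hf (TensorMod.mk φ m b) = f m b := rfl

/-- The biadditive map `(m, b) ↦ m ⊗ b`. -/
def TensorMod.mkHom : M →+ B →+ TensorMod φ M :=
  AddMonoidHom.mk' (fun m ↦ AddMonoidHom.mk' (TensorMod.mk φ m) (TensorMod.mk_add_right φ m))
    fun m m' ↦ AddMonoidHom.ext (TensorMod.mk_add_left φ m m')

instance [Module.Finite Aᵐᵒᵖ M] : Module.Finite Bᵐᵒᵖ (TensorMod φ M) := by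
  classical
  obtain ⟨s, hs⟩ := (inferInstance : Module.Finite Aᵐᵒᵖ M)
  refine ⟨s.image fun m ↦ TensorMod.mk φ m 1, ?_⟩
  rw [eq_top_iff]
  rintro x -
  induction x using TensorMod.induction with
  | h0 => exact Submodule.zero_mem _
  | h2 x y hx hy => exact Submodule.add_mem _ hx hy
  | h1 m b =>
    have hm : m ∈ Submodule.span Aᵐᵒᵖ (s : Set M) := hs ▸ Submodule.mem_top
    induction hm using Submodule.span_induction generalizing b with
    | mem m hm =>
      have h := Submodule.smul_mem (Submodule.span Bᵐᵒᵖ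
        (s.image fun m ↦ TensorMod.mk φ m 1 : Set (TensorMod φ M))) (op b)
        (Submodule.subset_span (Finset.mem_coe.2 (Finset.mem_image_of_mem _ hm)))
      rwa [TensorMod.op_smul_mk, one_mul] at h
    | zero => rw [TensorMod.mk_zero_left]; exact Submodule.zero_mem _
    | add m m' _ _ h h' => rw [TensorMod.mk_add_left]; exact Submodule.add_mem _ (h b) (h' b)
    | smul a m _ h =>
      have := h (φ a.unop * b)
      rwa [← TensorMod.mk_smul, op_unop] at this

/-- The map `M ⊗_A B → N ⊗_A B` induced by a linear map `M → N`. -/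
def TensorMod.map {N : Type u} [AddCommGroup N] [Module Aᵐᵒᵖ N] (f : M →ₗ[Aᵐᵒᵖ] N) :
    TensorMod φ M →ₗ[Bᵐᵒᵖ] TensorMod φ N where
  toFun := TensorMod.lift φ ((TensorMod.mkHom φ).comp f.toAddMonoidHom) fun m a b ↦ by
    change TensorMod.mk φ (f (op a • m)) b = TensorMod.mk φ (f m) (φ a * b)
    rw [map_smul, TensorMod.mk_smul]
  map_add' := map_add _
  map_smul' c x := by
    induction x using TensorMod.induction with
    | h0 => simp
    | h2 x y hx hy => simp_all
    | h1 m b => rfl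

theorem TensorMod.map_mk {N : Type u} [AddCommGroup N] [Module Aᵐᵒᵖ N] (f : M →ₗ[Aᵐᵒᵖ] N)
    (m : M) (b : B) :
    TensorMod.map φ f (TensorMod.mk φ m b) = TensorMod.mk φ (f m) b := rfl

/-- The map `m ⊗ b ↦ m ⊗ α(b)` for an additive map `α : B → B` that commutes with the left action
of `A`. -/
def TensorMod.mapRight (α : B →+ B) (hα : ∀ a b, α (φ a * b) = φ a * α b) :
    TensorMod φ M →+ TensorMod φ M :=
  TensorMod.lift φ (AddMonoidHom.mk' (fun m ↦ (TensorMod.mkHom φ m).comp α)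
    fun m m' ↦ AddMonoidHom.ext fun b ↦ TensorMod.mk_add_left φ m m' (α b)) fun m a b ↦ by
      change TensorMod.mk φ (op a • m) (α b) = TensorMod.mk φ m (α (φ a * b))
      rw [hα, TensorMod.mk_smul]

end Carrier

end Tensor

/-! ## Skew group algebras -/

section SkewGroupAlgebra

open TensorProduct MulOpposite

variable (k : Type u) [Field k] (Λ : Type u) [Ring Λ] [Algebra k Λ]
  (G : Type u) [Group G] [MulSemiringAction G Λ] [SMulCommClass G k Λ]

/-- The skew group algebra `ΛG`: finite sums of the elements `a ⊗ g = single g a`, with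
`(a ⊗ g) (b ⊗ h) = a g(b) ⊗ g h`. -/
abbrev SkewGroupAlgebra (Λ : Type*) [Ring Λ] (G : Type*) := SkewMonoidAlgebra Λ G

instance [Finite G] [Module.Finite k Λ] : Module.Finite k (SkewGroupAlgebra Λ G) :=
  Module.Finite.equiv (SkewMonoidAlgebra.coeffLinearEquiv (k := Λ) (G := G) (S := k)).symm

end SkewGroupAlgebra

section CharAction

/-- The character group of `G`: the homomorphisms `G → kˣ` with the pointwise product. -/
def CharGroup (k : Type*) [Field k] (G : Type*) [Group G] : Type _ := G →* kˣ

instance (k : Type*) [Field k] (G : Type*) [Group G] : CommGroup (CharGroup k G) :=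
  inferInstanceAs (CommGroup (G →* kˣ))

instance (k : Type*) [Field k] (G : Type*) [Group G] : FunLike (CharGroup k G) G kˣ :=
  inferInstanceAs (FunLike (G →* kˣ) G kˣ)

instance (k : Type*) [Field k] (G : Type*) [Group G] : MonoidHomClass (CharGroup k G) G kˣ :=
  inferInstanceAs (MonoidHomClass (G →* kˣ) G kˣ)

variable {k : Type*} [Field k] {R : Type*} [Ring R] [Algebra k R]
  {G : Type*} [Group G]

/-- The characters of `G` act on the skew group algebra of any `k`-algebra `R` with `G`-action:
`χ (a ⊗ g) = χ(g) a ⊗ g`. -/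
instance instCharSMul : SMul (CharGroup k G) (SkewMonoidAlgebra R G) where
  smul χ x := ⟨Finsupp.onFinset x.support (fun g ↦ (χ g : k) • x.coeff g) fun g hg ↦ by
    rw [SkewMonoidAlgebra.mem_support_iff]; rintro h; simp [h] at hg⟩

theorem coeff_char_smul (χ : CharGroup k G) (x : SkewMonoidAlgebra R G) (g : G) :
    (χ • x).coeff g = (χ g : k) • x.coeff g := rfl

theorem char_smul_single (χ : CharGroup k G) (g : G) (a : R) :
    χ • SkewMonoidAlgebra.single g a = SkewMonoidAlgebra.single g ((χ g : k) • a) := by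
  classical
  refine SkewMonoidAlgebra.ext fun h ↦ ?_
  rw [coeff_char_smul, SkewMonoidAlgebra.coeff_single_apply, SkewMonoidAlgebra.coeff_single_apply]
  split_ifs with e
  · rw [e]
  · exact smul_zero _

theorem char_smul_zero (χ : CharGroup k G) : χ • (0 : SkewMonoidAlgebra R G) = 0 :=
  SkewMonoidAlgebra.ext fun g ↦ smul_zero (χ g : k)

theorem char_smul_add (χ : CharGroup k G) (x y : SkewMonoidAlgebra R G) :
    χ • (x + y) = χ • x + χ • y := SkewMonoidAlgebra.ext fun g ↦ by
  simp only [coeff_char_smul, SkewMonoidAlgebra.coeff_add, Finsupp.add_apply, smul_add]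

variable [MulSemiringAction G R] [SMulCommClass G k R]

theorem char_smul_mul (χ : CharGroup k G) (x y : SkewMonoidAlgebra R G) :
    χ • (x * y) = (χ • x) * (χ • y) := by
  induction x using SkewMonoidAlgebra.induction_on with
  | zero => rw [zero_mul, char_smul_zero, zero_mul]
  | add x x' hx hx' => rw [add_mul, char_smul_add, char_smul_add, add_mul, hx, hx']
  | single g a =>
    induction y using SkewMonoidAlgebra.induction_on with
    | zero => rw [mul_zero, char_smul_zero, mul_zero]
    | add x x' hx hx' => rw [mul_add, char_smul_add, char_smul_add, mul_add, hx, hx']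
    | single h b =>
      simp only [SkewMonoidAlgebra.single_mul_single, char_smul_single, map_mul, Units.val_mul,
        smul_mul_assoc, mul_smul_comm, smul_comm g, mul_smul, smul_comm (χ h : k)]

instance instCharAction : MulSemiringAction (CharGroup k G) (SkewMonoidAlgebra R G) where
  one_smul x := SkewMonoidAlgebra.ext fun g ↦ one_smul k (x.coeff g)
  mul_smul χ ψ x := SkewMonoidAlgebra.ext fun g ↦ mul_smul (χ g : k) (ψ g : k) (x.coeff g)
  smul_zero := char_smul_zero
  smul_add := char_smul_add
  smul_one χ := by
    rw [SkewMonoidAlgebra.one_def, char_smul_single, map_one, Units.val_one, one_smul]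
  smul_mul := char_smul_mul

instance : SMulCommClass (CharGroup k G) k (SkewMonoidAlgebra R G) where
  smul_comm χ r x := SkewMonoidAlgebra.ext fun g ↦ smul_comm (χ g : k) r (x.coeff g)

end CharAction

/-! ## The functor `- ⊗_Λ ΛG` -/

section TensorSkew

open MulOpposite SkewMonoidAlgebra

variable (k : Type u) [Field k] (Λ : Type u) [Ring Λ] [Algebra k Λ]
  (G : Type u) [Group G] [MulSemiringAction G Λ] [SMulCommClass G k Λ]

/-- The right `ΛG`-module `M ⊗_Λ ΛG`, where `Λ → ΛG` is the map `a ↦ a ⊗ 1`. -/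
abbrev SkewTensor (M : Type u) [AddCommGroup M] [Module Λᵐᵒᵖ M] : Type u :=
  TensorMod (singleOneRingHom : Λ →+* SkewGroupAlgebra Λ G) M

section Exactness

variable {Λ G} {M N P : Type u} [AddCommGroup M] [Module Λᵐᵒᵖ M] [AddCommGroup N]
  [Module Λᵐᵒᵖ N] [AddCommGroup P] [Module Λᵐᵒᵖ P]

/-- The coefficient `m a` at `g` of `m ⊗ (a ⊗ g)`. -/
def SkewTensor.coeff (g : G) : SkewTensor Λ G M →+ M :=
  TensorMod.lift _
    (AddMonoidHom.mk' (fun m ↦ AddMonoidHom.mk' (fun b : SkewGroupAlgebra Λ G ↦ op (b.coeff g) • m)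
      fun b b' ↦ by rw [coeff_add, Finsupp.add_apply, MulOpposite.op_add, add_smul])
      fun m m' ↦ AddMonoidHom.ext fun b ↦ smul_add _ _ _) fun m a b ↦ by
    change op (b.coeff g) • op a • m = op ((single 1 a * b).coeff g) • m
    rw [coeff_single_one_mul, op_mul, mul_smul]

theorem SkewTensor.coeff_mk (g : G) (m : M) (b : SkewGroupAlgebra Λ G) :
    SkewTensor.coeff g (TensorMod.mk _ m b : SkewTensor Λ G M) = op (b.coeff g) • m := rfl

theorem SkewTensor.coeff_map (f : M →ₗ[Λᵐᵒᵖ] N) (g : G) (x : SkewTensor Λ G M) :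
    SkewTensor.coeff g (TensorMod.map _ f x) = f (SkewTensor.coeff g x) := by
  induction x using TensorMod.induction with
  | h0 => simp
  | h1 m b => rw [TensorMod.map_mk, coeff_mk, coeff_mk, map_smul]
  | h2 x y hx hy => simp only [map_add, hx, hy]

theorem SkewTensor.sum_coeff [Fintype G] (x : SkewTensor Λ G M) :
    ∑ g, (TensorMod.mk _ (SkewTensor.coeff g x) (single g 1) : SkewTensor Λ G M) = x := by
  classical
  induction x using TensorMod.induction with
  | h0 => simp [TensorMod.mk_zero_left]
  | h2 x y hx hy =>
    simp only [map_add, TensorMod.mk_add_left, Finset.sum_add_distrib, hx, hy]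
  | h1 m b =>
    induction b using SkewMonoidAlgebra.induction_on with
    | zero =>
      change _ = TensorMod.mkHom _ m 0
      rw [map_zero]
      refine Finset.sum_eq_zero fun g _ ↦ ?_
      rw [coeff_mk, coeff_zero, Finsupp.zero_apply, MulOpposite.op_zero, zero_smul, TensorMod.mk_zero_left]
    | add b b' hb hb' =>
      rw [TensorMod.mk_add_right]
      simp only [map_add, TensorMod.mk_add_left, Finset.sum_add_distrib, hb, hb']
    | single h a =>
      rw [Finset.sum_eq_single h]
      · rw [coeff_mk, coeff_single_apply, if_pos rfl, TensorMod.mk_smul]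
        change TensorMod.mk _ m (single 1 a * single h 1) = _
        rw [single_mul_single, one_mul, smul_one, mul_one]
      · intro g _ hg
        rw [coeff_mk, coeff_single_apply, if_neg (Ne.symm hg), MulOpposite.op_zero, zero_smul,
          TensorMod.mk_zero_left]
      · simp

theorem SkewTensor.ext [Finite G] {x y : SkewTensor Λ G M}
    (h : ∀ g, SkewTensor.coeff g x = SkewTensor.coeff g y) : x = y := by
  have := Fintype.ofFinite G
  rw [← SkewTensor.sum_coeff x, ← SkewTensor.sum_coeff y]
  simp only [h]

theorem SkewTensor.exact_map [Finite G] (f : M →ₗ[Λᵐᵒᵖ] N) (f' : N →ₗ[Λᵐᵒᵖ] P)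
    (h : Function.Exact f f') :
    Function.Exact
      (TensorMod.map (singleOneRingHom : Λ →+* SkewGroupAlgebra Λ G) f)
      (TensorMod.map (singleOneRingHom : Λ →+* SkewGroupAlgebra Λ G) f') := by
  classical
  have := Fintype.ofFinite G
  intro y
  constructor
  · intro hy
    have hc : ∀ g : G, ∃ m, f m = SkewTensor.coeff g y := fun g ↦ by
      refine (h _).1 ?_
      rw [← SkewTensor.coeff_map, hy, map_zero]
    choose m hm using hc
    refine ⟨∑ g, TensorMod.mk _ (m g) (single g 1), ?_⟩
    simp only [_root_.map_sum, TensorMod.map_mk, hm]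
    exact SkewTensor.sum_coeff y
  · rintro ⟨x, rfl⟩
    refine SkewTensor.ext fun g ↦ ?_
    rw [SkewTensor.coeff_map, SkewTensor.coeff_map, map_zero]
    exact (h _).2 ⟨_, rfl⟩

end Exactness

/-- The functor `- ⊗_Λ ΛG : mod Λ ⥤ mod ΛG`. -/
def skewTensor : FMod k Λ ⥤ FMod k (SkewGroupAlgebra Λ G) where
  obj M := FMod.of k (Λ := SkewGroupAlgebra Λ G) (SkewTensor Λ G M)
  map {M N} f := FMod.hom (M := FMod.of k (Λ := SkewGroupAlgebra Λ G) (SkewTensor Λ G M))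
    (N := FMod.of k (Λ := SkewGroupAlgebra Λ G) (SkewTensor Λ G N))
    (TensorMod.map _ (FMod.lin f))
  map_id M := FMod.ext fun x ↦ by
    induction x using TensorMod.induction with
    | h0 => exact (map_zero _).trans (map_zero _).symm
    | h1 m b => rfl
    | h2 x y hx hy => exact (map_add _ _ _).trans ((congrArg₂ (· + ·) hx hy).trans
        (map_add _ _ _).symm)
  map_comp f g := FMod.ext fun x ↦ by
    induction x using TensorMod.induction with
    | h0 => exact (map_zero _).trans (map_zero _).symm
    | h1 m b => rfl
    | h2 x y hx hy => exact (map_add _ _ _).trans ((congrArg₂ (· + ·) hx hy).trans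
        (map_add _ _ _).symm)

section

variable [Module.Finite k Λ] [Finite G]

instance : (skewTensor k Λ G).Additive where
  map_add {M N f g} := FMod.ext fun x ↦ by
    induction x using TensorMod.induction with
    | h0 => exact (map_zero _).trans (map_zero _).symm
    | h1 m b => exact TensorMod.mk_add_left _ (FMod.lin f m) (FMod.lin g m) b
    | h2 x y hx hy => exact (map_add _ _ _).trans ((congrArg₂ (· + ·) hx hy).trans
        (map_add _ _ _).symm)

instance : PreservesFiniteLimits (skewTensor k Λ G) :=
  (FMod.preserves (skewTensor k Λ G) fun _ _ h ↦ SkewTensor.exact_map _ _ h).1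

instance : PreservesFiniteColimits (skewTensor k Λ G) :=
  (FMod.preserves (skewTensor k Λ G) fun _ _ h ↦ SkewTensor.exact_map _ _ h).2

end

variable {k Λ G}

theorem char_smul_singleOne_mul (χ : CharGroup k G) (a : Λ) (b : SkewGroupAlgebra Λ G) :
    χ • (singleOneRingHom a * b) = (singleOneRingHom a : SkewGroupAlgebra Λ G) * χ • b := by
  rw [char_smul_mul]
  change χ • (single 1 a) * _ = single 1 a * _
  rw [char_smul_single, map_one, Units.val_one, one_smul]

/-- The map `m ⊗ b ↦ m ⊗ χ(b)` on `M ⊗_Λ ΛG`. -/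
def charMap (χ : CharGroup k G) (M : Type u) [AddCommGroup M] [Module Λᵐᵒᵖ M] :
    SkewTensor Λ G M →+ SkewTensor Λ G M :=
  TensorMod.mapRight _
    (AddMonoidHom.mk' (fun b : SkewGroupAlgebra Λ G ↦ χ • b) (char_smul_add χ))
    (char_smul_singleOne_mul χ)

theorem charMap_mk (χ : CharGroup k G) {M : Type u} [AddCommGroup M] [Module Λᵐᵒᵖ M] (m : M)
    (b : SkewGroupAlgebra Λ G) :
    charMap χ M (TensorMod.mk _ m b) = TensorMod.mk _ m (χ • b) := rfl

theorem charMap_mul (χ ψ : CharGroup k G) {M : Type u} [AddCommGroup M] [Module Λᵐᵒᵖ M]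
    (x : SkewTensor Λ G M) : charMap (χ * ψ) M x = charMap χ M (charMap ψ M x) := by
  induction x using TensorMod.induction with
  | h0 => simp
  | h1 m b =>
    rw [charMap_mk, charMap_mk, charMap_mk]
    exact congrArg (TensorMod.mk _ m) (mul_smul χ ψ b)
  | h2 x y hx hy => simp only [map_add, hx, hy]

theorem charMap_one {M : Type u} [AddCommGroup M] [Module Λᵐᵒᵖ M]
    (x : SkewTensor Λ G M) : charMap (1 : CharGroup k G) M x = x := by
  induction x using TensorMod.induction with
  | h0 => simp
  | h1 m b =>
    rw [charMap_mk]
    exact congrArg (TensorMod.mk _ m) (one_smul (CharGroup k G) b)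
  | h2 x y hx hy => simp only [map_add, hx, hy]

theorem charMap_op_smul (χ : CharGroup k G) {M : Type u} [AddCommGroup M] [Module Λᵐᵒᵖ M]
    (c : SkewGroupAlgebra Λ G) (x : SkewTensor Λ G M) :
    charMap χ M (op (χ⁻¹ • c) • x) = op c • charMap χ M x := by
  induction x using TensorMod.induction with
  | h0 => simp
  | h1 m b =>
    rw [TensorMod.op_smul_mk, charMap_mk, charMap_mk, TensorMod.op_smul_mk, char_smul_mul]
    exact congrArg (fun c ↦ TensorMod.mk _ m (χ • b * c)) (smul_inv_smul χ c)
  | h2 x y hx hy => simp only [smul_add, map_add, hx, hy]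

theorem charMap_map (χ : CharGroup k G) {M N : Type u} [AddCommGroup M] [Module Λᵐᵒᵖ M]
    [AddCommGroup N] [Module Λᵐᵒᵖ N] (f : M →ₗ[Λᵐᵒᵖ] N) (x : SkewTensor Λ G M) :
    charMap χ N (TensorMod.map _ f x) = TensorMod.map _ f (charMap χ M x) := by
  induction x using TensorMod.induction with
  | h0 => simp
  | h1 m b => rfl
  | h2 x y hx hy => simp only [map_add, hx, hy]

/-- The map `m ⊗ b ↦ m ⊗ χ(b)`, that is `m ⊗ (1 ⊗ g) ↦ χ(g) (m ⊗ (1 ⊗ g))`, as an isomorphism of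
right `ΛG`-modules `(M ⊗_Λ ΛG)^{χ⁻¹} → M ⊗_Λ ΛG`. -/
def charEquiv (χ : CharGroup k G) (M : Type u) [AddCommGroup M] [Module Λᵐᵒᵖ M] :
    TwistMod χ⁻¹ (SkewTensor Λ G M) ≃ₗ[(SkewGroupAlgebra Λ G)ᵐᵒᵖ] SkewTensor Λ G M where
  toFun x := charMap χ M x
  invFun x := charMap χ⁻¹ M x
  map_add' := (charMap χ M).map_add
  map_smul' c x := charMap_op_smul χ c.unop x
  left_inv x := (charMap_mul χ⁻¹ χ _).symm.trans
    ((congrArg (fun ψ ↦ charMap ψ M x) (inv_mul_cancel χ)).trans (charMap_one _))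
  right_inv x := (charMap_mul χ χ⁻¹ _).symm.trans
    ((congrArg (fun ψ ↦ charMap ψ M x) (mul_inv_cancel χ)).trans (charMap_one _))

variable (Λ) in
/-- The isomorphisms `(M ⊗_Λ ΛG)^{χ⁻¹} → M ⊗_Λ ΛG`, `m ⊗ b ↦ m ⊗ χ(b)`, as an isomorphism of
functors of `M`. -/
def charIso (χ : CharGroup k G) :
    skewTensor k Λ G ⋙ twist k (SkewGroupAlgebra Λ G) χ⁻¹ ≅ skewTensor k Λ G :=
  NatIso.ofComponents (fun M ↦ FMod.iso k
    (M := FMod.of k (Λ := SkewGroupAlgebra Λ G) (TwistMod χ⁻¹ (SkewTensor Λ G M)))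
    (N := FMod.of k (Λ := SkewGroupAlgebra Λ G) (SkewTensor Λ G M)) (charEquiv χ M))
    fun f ↦ FMod.ext fun x ↦ charMap_map χ (FMod.lin f) x

theorem charIso_mul (χ ψ : CharGroup k G) :
    (charIso Λ (χ * ψ)).hom =
      Functor.whiskerLeft (skewTensor k Λ G)
          (twistMul k (g := ψ⁻¹) (h := χ⁻¹) (l := (χ * ψ)⁻¹) (mul_inv_rev χ ψ).symm).hom ≫
        (Functor.associator _ _ _).inv ≫
          Functor.whiskerRight (charIso Λ ψ).hom (twist k (SkewGroupAlgebra Λ G) χ⁻¹) ≫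
            (charIso Λ χ).hom :=
  NatTrans.ext (funext fun _ ↦ FMod.ext fun x ↦ charMap_mul χ ψ x)

end TensorSkew

/-! ## `G`-invariant objects -/

section Invariant

section Twist

variable (k : Type u) [Field k] (Λ : Type u) [Ring Λ] [Algebra k Λ] [Module.Finite k Λ]
  {G : Type u} [Group G] [MulSemiringAction G Λ]

/-- The functor `X ↦ X^g = X ⊗^L_Λ Λ_g` on the bounded derived category. -/
def twistDb (g : G) : Db k Λ ⥤ Db k Λ := mapBounded (twist k Λ g)

instance (g : G) : (twistDb k Λ g).Additive := inferInstanceAs (mapBounded _).Additive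

instance [SMulCommClass G k Λ] (g : G) : (twistDb k Λ g).Linear k := inferInstanceAs ((mapBounded _).Linear k)

/-- The canonical isomorphism `X^l ≅ (X^g)^h` for `l = g h`. -/
def twistDbMul {g h l : G} (e : g * h = l) :
    twistDb k Λ l ≅ twistDb k Λ g ⋙ twistDb k Λ h :=
  boundedIso (twistMul k e) ≪≫ boundedComp (twist k Λ g) (twist k Λ h)

variable (G) in
/-- The canonical isomorphism `X^1 ≅ X`. -/
def twistDbOne : twistDb k Λ (1 : G) ≅ 𝟭 (Db k Λ) :=
  boundedIso (twistOne k (Λ := Λ) G) ≪≫ boundedId (FMod k Λ)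

theorem twistDb_one_map_injective {X Y : Db k Λ} :
    Function.Injective ((twistDb k Λ (1 : G)).map : (X ⟶ Y) → _) := by
  intro f f' h
  have n (f : X ⟶ Y) := (twistDbOne k Λ G).hom.naturality f
  have h' : (twistDbOne k Λ G).hom.app X ≫ f = (twistDbOne k Λ G).hom.app X ≫ f' :=
    (n f).symm.trans ((congrArg (· ≫ (twistDbOne k Λ G).hom.app Y) h).trans (n f'))
  exact (cancel_epi _).1 h'

end Twist

variable {k : Type u} [Field k] {Λ : Type u} [Ring Λ] [Algebra k Λ] [Module.Finite k Λ]

/-- The structure of a `G`-invariant object on `X` in the bounded derived category of the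
`G`-algebra `Λ`: isomorphisms `ι_g : X^{g⁻¹} → X` with `ι_{gh} = ι_g ∘ (ι_h)^{g⁻¹}`, where
`X^{(gh)⁻¹} = (X^{h⁻¹})^{g⁻¹}` canonically. -/
structure Invariant (G : Type u) [Group G] [MulSemiringAction G Λ] [SMulCommClass G k Λ]
    (X : Db k Λ) where
  /-- The isomorphism `ι_g`. -/
  ι (g : G) : (twistDb k Λ g⁻¹).obj X ≅ X
  ι_mul (g h : G) : (ι (g * h)).hom =
    (twistDbMul k Λ (g := h⁻¹) (h := g⁻¹) (l := (g * h)⁻¹) (mul_inv_rev g h).symm).hom.app X ≫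
      (twistDb k Λ g⁻¹).map (ι h).hom ≫ (ι g).hom

theorem conj_aux {C : Type*} [Category* C] {X : C} (T T' T'' : C ⥤ C) (c : T'' ≅ T' ⋙ T)
    (i : T.obj X ≅ X) (j : T'.obj X ≅ X) (l : T''.obj X ≅ X)
    (hl : l.hom = c.hom.app X ≫ T.map j.hom ≫ i.hom) (f : X ⟶ X) :
    l.inv ≫ T''.map f ≫ l.hom = i.inv ≫ T.map (j.inv ≫ T'.map f ≫ j.hom) ≫ i.hom := by
  rw [Iso.inv_comp_eq, hl]
  have h₁ : T.map j.hom ≫ T.map j.inv = 𝟙 _ := by rw [← T.map_comp, j.hom_inv_id, T.map_id]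
  simp only [assoc, Iso.hom_inv_id_assoc, Functor.map_comp, reassoc_of% h₁]
  exact c.hom.naturality_assoc f _

theorem conj_mul {C : Type*} [Category* C] {X : C} {T : C ⥤ C} (i : T.obj X ≅ X)
    (f f' : X ⟶ X) :
    i.inv ≫ T.map (𝟙 X) ≫ i.hom = 𝟙 X ∧
    i.inv ≫ T.map (f ≫ f') ≫ i.hom =
      (i.inv ≫ T.map f ≫ i.hom) ≫ (i.inv ≫ T.map f' ≫ i.hom) := by
  simp

theorem conj_lin {C : Type*} [Category* C] [Preadditive C] {R : Type*} [Ring R] [Linear R C]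
    {X : C} {T : C ⥤ C} [T.Additive] [T.Linear R] (i : T.obj X ≅ X) (f f' : X ⟶ X) (r : R) :
    i.inv ≫ T.map (0 : X ⟶ X) ≫ i.hom = 0 ∧
    i.inv ≫ T.map (f + f') ≫ i.hom = i.inv ≫ T.map f ≫ i.hom + i.inv ≫ T.map f' ≫ i.hom ∧
    i.inv ≫ T.map (r • f) ≫ i.hom = r • (i.inv ≫ T.map f ≫ i.hom) := by
  simp [T.map_smul]

/-- The endomorphism algebra of a `G`-invariant object, with composition of maps as product. -/
def EndAlg {G : Type u} [Group G] [MulSemiringAction G Λ] [SMulCommClass G k Λ]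
    {X : Db k Λ} (_ : Invariant G X) : Type (u + 1) := End X

namespace EndAlg

variable {G : Type u} [Group G] [MulSemiringAction G Λ] [SMulCommClass G k Λ]
    {X : Db k Λ} (I : Invariant G X)

instance : Ring (EndAlg I) := inferInstanceAs (Ring (End X))

instance : Algebra k (EndAlg I) := inferInstanceAs (Algebra k (End X))

/-- The action of `g` on endomorphisms: `g f = ι_g ∘ f^{g⁻¹} ∘ ι_g⁻¹`. -/
instance : SMul G (EndAlg I) where
  smul g f := ((I.ι g).inv ≫ (twistDb k Λ g⁻¹).map f ≫ (I.ι g).hom : X ⟶ X)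

theorem mul_smul' (g h : G) (f : EndAlg I) : (g * h) • f = g • h • f :=
  conj_aux _ _ _ _ (I.ι g) (I.ι h) (I.ι (g * h)) (I.ι_mul g h) f

theorem one_smul_injective : Function.Injective (fun f : EndAlg I ↦ (1 : G) • f) := by
  intro f f' h
  have h' : (twistDb k Λ (1 : G)⁻¹).map f = (twistDb k Λ (1 : G)⁻¹).map f' :=
    (cancel_mono (I.ι 1).hom).1 ((cancel_epi (I.ι 1).inv).1 h)
  rw [inv_one] at h'
  exact twistDb_one_map_injective k Λ h'

instance : MulSemiringAction G (EndAlg I) where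
  one_smul f := one_smul_injective I (by
    change (1 : G) • (1 : G) • f = (1 : G) • f
    rw [← mul_smul', mul_one])
  mul_smul := mul_smul' I
  smul_zero g := (conj_lin (I.ι g) 0 0 (0 : k)).1
  smul_add g f f' := (conj_lin (I.ι g) f f' (0 : k)).2.1
  smul_one g := (conj_mul (I.ι g) (𝟙 X) (𝟙 X)).1
  smul_mul g f f' := (conj_mul (I.ι g) f' f).2

instance : SMulCommClass G k (EndAlg I) where
  smul_comm g r f := (conj_lin (I.ι g) f f r).2.2

end EndAlg

end Invariant

/-! ## The derived functor `- ⊗^L_Λ ΛG` -/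

section Induced

variable {k : Type u} [Field k] {Λ : Type u} [Ring Λ] [Algebra k Λ] [Module.Finite k Λ]
  {G : Type u} [Group G] [Finite G] [MulSemiringAction G Λ] [SMulCommClass G k Λ]

variable (k Λ G) in
/-- The functor `X ↦ X ⊗^L_Λ ΛG` from the bounded derived category of `Λ` to that of `ΛG`. As `ΛG`
is free as a left `Λ`-module, the functor `- ⊗_Λ ΛG` is exact, and its left derived functor applies
it to complexes degree by degree. -/
def skewTensorDb : Db k Λ ⥤ Db k (SkewGroupAlgebra Λ G) := mapBounded (skewTensor k Λ G)

variable (Λ) in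
/-- The isomorphisms `(X ⊗^L_Λ ΛG)^{χ⁻¹} → X ⊗^L_Λ ΛG` induced by `m ⊗ b ↦ m ⊗ χ(b)`. -/
def charIsoDb (χ : CharGroup k G) :
    skewTensorDb k Λ G ⋙ twistDb k (SkewGroupAlgebra Λ G) χ⁻¹ ≅ skewTensorDb k Λ G :=
  (boundedComp (skewTensor k Λ G) (twist k (SkewGroupAlgebra Λ G) χ⁻¹)).symm ≪≫
    boundedIso (charIso Λ χ)

/-- The canonical structure of an invariant object under the character group on `X ⊗^L_Λ ΛG`. -/
def inducedInvariant (X : Db k Λ) : Invariant (CharGroup k G) ((skewTensorDb k Λ G).obj X) where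
  ι χ := (charIsoDb Λ χ).app X
  ι_mul χ ψ := by
    refine ObjectProperty.hom_ext _ ?_
    exact derivedComp_cocycle _ _ _ _ (charIso_mul χ ψ) X.obj

end Induced

end GAlg

end

/-! Write F for `- ⊗^L_Λ ΛG` and R for the restriction of scalars along Λ → ΛG. Both come from exact
functors and F is left adjoint to R, so End(FX) = Hom(X, RFX). As a right Λ-module, M ⊗_Λ ΛG is the
direct sum over g of its pieces M ⊗ g⁻¹, and the piece at g⁻¹ is the twist M^{g⁻¹}, because g⁻¹ a =
g⁻¹(a) g⁻¹ in ΛG. Hence RFX is the direct sum of the X^{g⁻¹}. Each Hom(X, X^{g⁻¹}) is a copy of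
End(X) through f ↦ f^{g⁻¹} ∘ ι_g⁻¹, since g acts bijectively on End(X). So End(FX) has the size of
the skew group algebra, and what remains is the product.

The element of End(FX) that stands for 1 ⊗ g is w_g = `translate I g⁻¹`. Here `translate I g` is m ⊗
b ↦ ι_g⁻¹(m) ⊗ g⁻¹ b, the map with f = 1 in the component at g. The cocycle condition on ι gives
w_{gh} = w_g w_h, naturality gives w_g F(f) = F(g.f) w_g, and the decomposition above says that
every endomorphism is uniquely ∑ F(f_g) w_g (`existsUnique_sum_translate`). By
`exists_algEquiv_skewMonoidAlgebra` these three facts are enough. For the characters, χ fixes each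
F(f) and multiplies w_g by χ(g), because χ acts on the factor ΛG only (`map_char`, `translate_char`,
`map_char_smul`).

All the identities needed in the derived category are identities between natural maps of modules.
The notion `Model.Lifts` transports them: a transformation out of a derived category is determined
by its values on complexes, so an equation that holds for modules holds for complexes degree by
degree, and then for derived functors. -/

noncomputable section

open CategoryTheory Category Limits DerivedCategory

namespace GAlg

/-! ## Transformations of derived functors that come from complexes -/

section Model

variable {C₁ C₂ C₃ : Type*} [Category* C₁] [Category* C₂] [Category* C₃]
  [Abelian C₁] [Abelian C₂] [Abelian C₃]
  [HasDerivedCategory C₁] [HasDerivedCategory C₂] [HasDerivedCategory C₃]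

variable (C₁ C₂) in
/-- A functor between derived categories, together with a functor on complexes that induces it. -/
structure Model where
  /-- The functor on derived categories. -/
  der : DerivedCategory C₁ ⥤ DerivedCategory C₂
  /-- The functor on complexes. -/
  cx : CochainComplex C₁ ℤ ⥤ CochainComplex C₂ ℤ
  /-- The compatibility of the two functors. -/
  iso : Q ⋙ der ≅ cx ⋙ Q

namespace Model

variable (C₁) in
/-- The identity functor, with its model on complexes. -/
@[simps]
def id : Model C₁ C₁ where
  der := 𝟭 _
  cx := 𝟭 _
  iso := Q.rightUnitor ≪≫ Q.leftUnitor.symm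

/-- The functor given by an exact functor, with its model on complexes. -/
@[simps]
def ofExact (F : C₁ ⥤ C₂) [F.Additive] [PreservesFiniteLimits F] [PreservesFiniteColimits F] :
    Model C₁ C₂ where
  der := F.mapDerivedCategory
  cx := F.mapHomologicalComplex _
  iso := F.mapDerivedCategoryFactors

/-- The composition of functors with models on complexes. -/
@[simps der cx]
def comp (M : Model C₁ C₂) (N : Model C₂ C₃) : Model C₁ C₃ where
  der := M.der ⋙ N.der
  cx := M.cx ⋙ N.cx
  iso := NatIso.ofComponents (fun K ↦ N.der.mapIso (M.iso.app K) ≪≫ N.iso.app (M.cx.obj K))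
    fun {K L} f ↦ by
      have h₁ := congrArg N.der.map (M.iso.hom.naturality f)
      have h₂ := N.iso.hom.naturality (M.cx.map f)
      simp only [Functor.comp_map, Functor.map_comp] at h₁ h₂
      simp only [Functor.comp_map, Iso.trans_hom, Functor.mapIso_hom, Iso.app_hom, assoc]
      erw [← h₂]
      exact (reassoc_of% h₁) _

theorem comp_iso_hom_app (M : Model C₁ C₂) (N : Model C₂ C₃) (K : CochainComplex C₁ ℤ) :
    (M.comp N).iso.hom.app K = N.der.map (M.iso.hom.app K) ≫ N.iso.hom.app (M.cx.obj K) := rfl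

/-- A transformation on derived categories is induced by a transformation on complexes. -/
def Lifts (M N : Model C₁ C₂) (θ : M.der ⟶ N.der) (θ' : M.cx ⟶ N.cx) : Prop :=
  ∀ K, θ.app (Q.obj K) ≫ N.iso.hom.app K = M.iso.hom.app K ≫ Q.map (θ'.app K)

/-- The transformation on derived categories induced by a transformation on complexes. -/
def lift (M N : Model C₁ C₂) (θ' : M.cx ⟶ N.cx) : M.der ⟶ N.der :=
  letI : Localization.Lifting Q (HomologicalComplex.quasiIso C₁ (ComplexShape.up ℤ))
    (M.cx ⋙ Q) M.der := ⟨M.iso⟩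
  letI : Localization.Lifting Q (HomologicalComplex.quasiIso C₁ (ComplexShape.up ℤ))
    (N.cx ⋙ Q) N.der := ⟨N.iso⟩
  Localization.liftNatTrans Q (HomologicalComplex.quasiIso C₁ (ComplexShape.up ℤ))
    (M.cx ⋙ Q) (N.cx ⋙ Q) _ _ (Functor.whiskerRight θ' Q)

theorem lifts_lift (M N : Model C₁ C₂) (θ' : M.cx ⟶ N.cx) : Lifts M N (lift M N θ') θ' := by
  intro K
  let _ : Localization.Lifting Q (HomologicalComplex.quasiIso C₁ (ComplexShape.up ℤ))
    (M.cx ⋙ Q) M.der := ⟨M.iso⟩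
  let _ : Localization.Lifting Q (HomologicalComplex.quasiIso C₁ (ComplexShape.up ℤ))
    (N.cx ⋙ Q) N.der := ⟨N.iso⟩
  have h : (lift M N θ').app (Q.obj K) =
      M.iso.hom.app K ≫ Q.map (θ'.app K) ≫ N.iso.inv.app K :=
    Localization.liftNatTrans_app Q (HomologicalComplex.quasiIso C₁ (ComplexShape.up ℤ))
      (M.cx ⋙ Q) (N.cx ⋙ Q) _ _ (Functor.whiskerRight θ' Q) K
  rw [h, assoc, assoc, ← NatTrans.comp_app, N.iso.inv_hom_id]
  exact congrArg _ (comp_id _)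

namespace Lifts

variable {M N P : Model C₁ C₂}

/-- `Q` is a localization functor, so a transformation is determined by its components at the
objects `Q.obj K`, and these are fixed by the map on complexes because `N.iso` is invertible. -/
theorem ext {θ₁ θ₂ : M.der ⟶ N.der} {θ' : M.cx ⟶ N.cx} (h₁ : Lifts M N θ₁ θ')
    (h₂ : Lifts M N θ₂ θ') : θ₁ = θ₂ :=
  Localization.natTrans_ext Q (HomologicalComplex.quasiIso C₁ (ComplexShape.up ℤ)) fun K ↦
    (cancel_mono (N.iso.hom.app K)).1 ((h₁ K).trans (h₂ K).symm)

theorem id (M : Model C₁ C₂) : Lifts M M (𝟙 _) (𝟙 _) := fun K ↦ by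
  simp only [NatTrans.id_app, Q.map_id]
  exact (id_comp _).trans (comp_id _).symm

theorem comp {θ : M.der ⟶ N.der} {σ : N.der ⟶ P.der} {θ' : M.cx ⟶ N.cx} {σ' : N.cx ⟶ P.cx}
    (h : Lifts M N θ θ') (h' : Lifts N P σ σ') : Lifts M P (θ ≫ σ) (θ' ≫ σ') := fun K ↦ by
  have e := h' K
  have e' := h K
  rw [NatTrans.comp_app, NatTrans.comp_app, Q.map_comp, assoc, e]
  exact (reassoc_of% e') _

theorem add {θ σ : M.der ⟶ N.der} {θ' σ' : M.cx ⟶ N.cx}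
    (h : Lifts M N θ θ') (h' : Lifts M N σ σ') : Lifts M N (θ + σ) (θ' + σ') := fun K ↦ by
  have e := congrArg₂ (· + ·) (h K) (h' K)
  refine Eq.trans ?_ (e.trans ?_)
  · exact Preadditive.add_comp ..
  · rw [NatTrans.app_add, Q.map_add, Preadditive.comp_add]

theorem zero : Lifts M N 0 0 := fun K ↦ by
  refine Eq.trans zero_comp (Eq.trans comp_zero.symm (congrArg _ ?_))
  exact Q.map_zero _ _ |>.symm

theorem sum {ι : Type*} (s : Finset ι) {θ : ι → (M.der ⟶ N.der)} {θ' : ι → (M.cx ⟶ N.cx)}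
    (h : ∀ i, Lifts M N (θ i) (θ' i)) : Lifts M N (∑ i ∈ s, θ i) (∑ i ∈ s, θ' i) := by
  classical
  induction s using Finset.induction_on with
  | empty => exact zero
  | insert i s hi ih => rw [Finset.sum_insert hi, Finset.sum_insert hi]; exact (h i).add ih

theorem smul {R : Type*} [CommRing R] [Linear R C₁] [Linear R C₂] (r : R) {θ : M.der ⟶ N.der}
    {θ' : M.cx ⟶ N.cx} (h : Lifts M N θ θ') : Lifts M N (r • θ) (r • θ') := fun K ↦ by
  have e := congrArg (r • ·) (h K)
  refine Eq.trans ?_ (e.trans ?_)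
  · exact Linear.smul_comp ..
  · rw [NatTrans.app_smul, Functor.map_smul]
    exact (Linear.comp_smul ..).symm

theorem whiskerRight {θ : M.der ⟶ N.der} {θ' : M.cx ⟶ N.cx} (h : Lifts M N θ θ')
    (H : Model C₂ C₃) : Lifts (M.comp H) (N.comp H) (Functor.whiskerRight θ H.der)
      (Functor.whiskerRight θ' H.cx) := fun K ↦ by
  have e := congrArg H.der.map (h K)
  have e' := H.iso.hom.naturality (θ'.app K)
  rw [H.der.map_comp, H.der.map_comp] at e
  refine Eq.trans ?_ (((reassoc_of% e) (H.iso.hom.app (N.cx.obj K))).trans ?_)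
  · rfl
  · exact (congrArg (H.der.map (M.iso.hom.app K) ≫ ·) e').trans (assoc _ _ _).symm

theorem whiskerLeft {H H' : Model C₂ C₃} {θ : H.der ⟶ H'.der} {θ' : H.cx ⟶ H'.cx}
    (M : Model C₁ C₂) (h : Lifts H H' θ θ') :
    Lifts (M.comp H) (M.comp H') (Functor.whiskerLeft M.der θ)
      (Functor.whiskerLeft M.cx θ') := fun K ↦ by
  have e := h (M.cx.obj K)
  have e' := θ.naturality (M.iso.hom.app K)
  refine Eq.trans ((reassoc_of% e') (H'.iso.hom.app (M.cx.obj K))).symm ?_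
  exact (congrArg (H.der.map (M.iso.hom.app K) ≫ ·) e).trans (assoc _ _ _).symm

theorem derivedTrans {F F' : C₁ ⥤ C₂} [F.Additive] [PreservesFiniteLimits F]
    [PreservesFiniteColimits F] [F'.Additive] [PreservesFiniteLimits F']
    [PreservesFiniteColimits F'] (τ : F ⟶ F') :
    Lifts (ofExact F) (ofExact F') (GAlg.derivedTrans τ)
      (NatTrans.mapHomologicalComplex τ _) :=
  lifts_lift (ofExact F) (ofExact F') _

/-- Applying F and then H to a complex is the same as applying the composite in each degree, so the
comparison of derived functors lies over an identity. The factorization isomorphisms in its formula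
cancel those of the composite model. -/
theorem derivedComp (F : C₁ ⥤ C₂) [F.Additive] [PreservesFiniteLimits F]
    [PreservesFiniteColimits F] (H : C₂ ⥤ C₃) [H.Additive] [PreservesFiniteLimits H]
    [PreservesFiniteColimits H] :
    Lifts (ofExact (F ⋙ H)) ((ofExact F).comp (ofExact H)) (GAlg.derivedComp F H).hom
      (𝟙 ((F ⋙ H).mapHomologicalComplex _)) := fun K ↦ by
  refine (congrArg (· ≫ ((ofExact F).comp (ofExact H)).iso.hom.app K)
    (derivedComp_hom_app F H K)).trans ?_
  rw [comp_iso_hom_app]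
  have h₁ : H.mapDerivedCategory.map (F.mapDerivedCategoryFactors.inv.app K) ≫
      H.mapDerivedCategory.map (F.mapDerivedCategoryFactors.hom.app K) = 𝟙 _ := by
    rw [← Functor.map_comp, Iso.inv_hom_id_app]; exact H.mapDerivedCategory.map_id _
  have h₂ := H.mapDerivedCategoryFactors.inv_hom_id_app ((F.mapHomologicalComplex _).obj K)
  refine (assoc _ _ _).trans (congrArg ((F ⋙ H).mapDerivedCategoryFactors.hom.app K ≫ ·) ?_)
  refine (assoc _ _ _).trans (Eq.trans ?_ (h₂.trans (Q.map_id _).symm))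
  exact congrArg _ ((reassoc_of% h₁) _)

theorem inv {e : M.der ≅ N.der} {e' : M.cx ≅ N.cx} (h : Lifts M N e.hom e'.hom) :
    Lifts N M e.inv e'.inv := fun K ↦ by
  refine (cancel_epi (e.hom.app (Q.obj K))).1 ?_
  have h₁ := e.hom_inv_id_app (Q.obj K)
  have h₂ : Q.map (e'.hom.app K) ≫ Q.map (e'.inv.app K) = 𝟙 _ := by
    rw [← Q.map_comp, Iso.hom_inv_id_app, Q.map_id]
  have h₃ := h K
  rw [reassoc_of% h₁, reassoc_of% h₃, h₂]
  exact (comp_id _).symm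

theorem derivedComp_inv (F : C₁ ⥤ C₂) [F.Additive] [PreservesFiniteLimits F]
    [PreservesFiniteColimits F] (H : C₂ ⥤ C₃) [H.Additive] [PreservesFiniteLimits H]
    [PreservesFiniteColimits H] :
    Lifts ((ofExact F).comp (ofExact H)) (ofExact (F ⋙ H)) (GAlg.derivedComp F H).inv
      (𝟙 ((F ⋙ H).mapHomologicalComplex _)) :=
  inv (M := ofExact (F ⋙ H)) (N := (ofExact F).comp (ofExact H)) (e := GAlg.derivedComp F H)
    (e' := Iso.refl ((F ⋙ H).mapHomologicalComplex _)) (derivedComp F H)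

end Lifts

end Model

end Model

/-! ## Restriction of scalars along `Λ → ΛG` and its adjunction with `- ⊗_Λ ΛG` -/

section Restrict

open MulOpposite SkewMonoidAlgebra

variable (k : Type u) [Field k] (Λ : Type u) [Ring Λ] [Algebra k Λ]
  (G : Type u) [Group G] [MulSemiringAction G Λ] [SMulCommClass G k Λ]

/-- A right `ΛG`-module, as a right `Λ`-module. -/
@[nolint unusedArguments]
def RestrictMod (_ : Type u) (_ : Type u) (N : Type u) : Type u := N

instance (N : Type u) [AddCommGroup N] : AddCommGroup (RestrictMod Λ G N) :=
  inferInstanceAs (AddCommGroup N)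

instance instModuleRestrictMod (N : Type u) [AddCommGroup N]
    [Module (SkewGroupAlgebra Λ G)ᵐᵒᵖ N] : Module Λᵐᵒᵖ (RestrictMod Λ G N) :=
  Module.compHom N (singleOneRingHom : Λ →+* SkewGroupAlgebra Λ G).op

/-- The field k decides finiteness on both sides: ΛG is finite dimensional, so N is finite
dimensional over k, hence finitely generated over Λ. -/
theorem finite_restrictMod (k : Type u) [Field k] (Λ : Type u) [Ring Λ] [Algebra k Λ]
    [Module.Finite k Λ] (G : Type u) [Group G] [Finite G] [MulSemiringAction G Λ]
    [SMulCommClass G k Λ] (N : Type u) [AddCommGroup N]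
    [Module (SkewGroupAlgebra Λ G)ᵐᵒᵖ N] [Module.Finite (SkewGroupAlgebra Λ G)ᵐᵒᵖ N] :
    Module.Finite Λᵐᵒᵖ (RestrictMod Λ G N) := by
  have : Module.Finite k (SkewGroupAlgebra Λ G)ᵐᵒᵖ :=
    Module.Finite.equiv (MulOpposite.opLinearEquiv k)
  let _ : Module k N := Module.compHom N (algebraMap k (SkewGroupAlgebra Λ G)ᵐᵒᵖ)
  have : IsScalarTower k (SkewGroupAlgebra Λ G)ᵐᵒᵖ N :=
    ⟨fun r b n ↦ by rw [Algebra.smul_def, mul_smul]; rfl⟩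
  have : Module.Finite k N := Module.Finite.trans (SkewGroupAlgebra Λ G)ᵐᵒᵖ N
  let _ : Module k (RestrictMod Λ G N) := inferInstanceAs (Module k N)
  have : Module.Finite k (RestrictMod Λ G N) := inferInstanceAs (Module.Finite k N)
  -- The k-structure was defined through ΛG; it agrees with the one through Λ because k → ΛG factors
  -- through a ↦ a ⊗ 1.
  have : IsScalarTower k Λᵐᵒᵖ (RestrictMod Λ G N) :=
    ⟨fun r a n ↦ by rw [Algebra.smul_def, mul_smul]; rfl⟩
  exact Module.Finite.of_restrictScalars_finite k Λᵐᵒᵖ _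

/-- The map `m ↦ m ⊗ 1` from a right `Λ`-module `M` to `M ⊗_Λ ΛG`. -/
def skewUnitLin (M : Type u) [AddCommGroup M] [Module Λᵐᵒᵖ M] :
    M →ₗ[Λᵐᵒᵖ] RestrictMod Λ G (SkewTensor Λ G M) where
  toFun m := TensorMod.mk _ m 1
  map_add' m m' := TensorMod.mk_add_left _ m m' 1
  map_smul' a m := by
    refine (TensorMod.mk_smul _ m a.unop 1).trans ?_
    rw [mul_one, ← one_mul (singleOneRingHom a.unop), ← TensorMod.op_smul_mk]
    rfl

/-- The biadditive map `(n, b) ↦ n b`. -/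
def rightMulHom (N : Type u) [AddCommGroup N] [Module (SkewGroupAlgebra Λ G)ᵐᵒᵖ N] :
    RestrictMod Λ G N →+ SkewGroupAlgebra Λ G →+ N :=
  show N →+ SkewGroupAlgebra Λ G →+ N from
    AddMonoidHom.mk' (fun n ↦ AddMonoidHom.mk' (fun b ↦ op b • n)
      fun b b' ↦ add_smul (op b) (op b') n)
      fun n n' ↦ AddMonoidHom.ext fun b ↦ smul_add (op b) n n'

theorem rightMulHom_balanced (N : Type u) [AddCommGroup N]
    [Module (SkewGroupAlgebra Λ G)ᵐᵒᵖ N] (n : RestrictMod Λ G N) (a : Λ)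
    (b : SkewGroupAlgebra Λ G) :
    rightMulHom Λ G N (op a • n) b = rightMulHom Λ G N n (singleOneRingHom a * b) := by
  change op b • op (singleOneRingHom a : SkewGroupAlgebra Λ G) • (show N from n) =
    op (singleOneRingHom a * b) • (show N from n)
  rw [op_mul, mul_smul]

/-- The additive map `N ⊗_Λ ΛG → N`, `n ⊗ b ↦ n b`. -/
def rightMulMap (N : Type u) [AddCommGroup N] [Module (SkewGroupAlgebra Λ G)ᵐᵒᵖ N] :
    SkewTensor Λ G (RestrictMod Λ G N) →+ N :=
  TensorMod.lift _ (rightMulHom Λ G N) (rightMulHom_balanced Λ G N)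

theorem rightMulMap_mk (N : Type u) [AddCommGroup N] [Module (SkewGroupAlgebra Λ G)ᵐᵒᵖ N]
    (n : RestrictMod Λ G N) (b : SkewGroupAlgebra Λ G) :
    rightMulMap Λ G N (TensorMod.mk _ n b) = op b • (show N from n) := rfl

theorem rightMulMap_smul (N : Type u) [AddCommGroup N] [Module (SkewGroupAlgebra Λ G)ᵐᵒᵖ N]
    (c : (SkewGroupAlgebra Λ G)ᵐᵒᵖ) (x : SkewTensor Λ G (RestrictMod Λ G N)) :
    rightMulMap Λ G N (c • x) = c • rightMulMap Λ G N x := by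
  obtain ⟨c, rfl⟩ := op_surjective c
  induction x using TensorMod.induction with
  | h0 => rw [smul_zero, map_zero, smul_zero]
  | h1 m b => rw [TensorMod.op_smul_mk, rightMulMap_mk, rightMulMap_mk, op_mul, mul_smul]
  | h2 x y hx hy => rw [smul_add, map_add, map_add, hx, hy, smul_add]

/-- The counit `n ⊗ b ↦ n b` of the adjunction between `- ⊗_Λ ΛG` and the restriction of
scalars. -/
def skewCounitLin (N : Type u) [AddCommGroup N] [Module (SkewGroupAlgebra Λ G)ᵐᵒᵖ N] :
    SkewTensor Λ G (RestrictMod Λ G N) →ₗ[(SkewGroupAlgebra Λ G)ᵐᵒᵖ] N where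
  toFun := rightMulMap Λ G N
  map_add' := map_add _
  map_smul' := rightMulMap_smul Λ G N

/-- Moving a to the left past g turns it into g(a). This makes the coefficient at g linear with
values in the twist M^g. -/
theorem SkewTensor.coeff_op_smul {M : Type u} [AddCommGroup M] [Module Λᵐᵒᵖ M] (g : G) (a : Λ)
    (x : SkewTensor Λ G M) :
    SkewTensor.coeff g (op (single 1 a : SkewGroupAlgebra Λ G) • x) =
      op (g • a) • SkewTensor.coeff g x := by
  induction x using TensorMod.induction with
  | h0 => simp
  | h2 x y hx hy => rw [smul_add, map_add, map_add, hx, hy, smul_add]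
  | h1 m b =>
    rw [TensorMod.op_smul_mk, SkewTensor.coeff_mk, SkewTensor.coeff_mk, coeff_mul_single_one,
      op_mul, mul_smul]

/-- The map `M^{g⁻¹} → M ⊗_Λ ΛG`, `m ↦ m ⊗ (1 ⊗ g⁻¹)`, of right `Λ`-modules. -/
def twistInclLin (g : G) (M : Type u) [AddCommGroup M] [Module Λᵐᵒᵖ M] :
    TwistMod g⁻¹ M →ₗ[Λᵐᵒᵖ] RestrictMod Λ G (SkewTensor Λ G M) where
  toFun m := TensorMod.mk _ (show M from m) (single g⁻¹ 1)
  map_add' m m' := TensorMod.mk_add_left _ (show M from m) (show M from m') _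
  map_smul' a m := by
    refine (TensorMod.mk_smul _ (show M from m) (g⁻¹ • a.unop) _).trans ?_
    refine Eq.trans (congrArg (TensorMod.mk _ (show M from m)) ?_)
      (TensorMod.op_smul_mk _ (show M from m) (single g⁻¹ 1) (single 1 a.unop)).symm
    change single 1 (g⁻¹ • a.unop) * single g⁻¹ 1 = _
    rw [single_mul_single, single_mul_single, one_mul, mul_one, smul_one, mul_one, one_mul]

/-- The map `M ⊗_Λ ΛG → M^{g⁻¹}` of right `Λ`-modules to the coefficient at `g⁻¹`. -/
def twistProjLin (g : G) (M : Type u) [AddCommGroup M] [Module Λᵐᵒᵖ M] :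
    RestrictMod Λ G (SkewTensor Λ G M) →ₗ[Λᵐᵒᵖ] TwistMod g⁻¹ M where
  toFun := SkewTensor.coeff g⁻¹
  map_add' := map_add (SkewTensor.coeff g⁻¹)
  map_smul' a x := SkewTensor.coeff_op_smul Λ G g⁻¹ a.unop x

/-- A scalar of k is central in ΛG, so it can pass from the factor M across b to the right action.
This gives the k-linearity of `- ⊗_Λ ΛG`. -/
theorem SkewTensor.map_smul_algebraMap (k : Type u) [Field k] {Λ : Type u} [Ring Λ] [Algebra k Λ]
    {G : Type u} [Group G] [MulSemiringAction G Λ] [SMulCommClass G k Λ] {M N : Type u}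
    [AddCommGroup M] [Module Λᵐᵒᵖ M] [AddCommGroup N] [Module Λᵐᵒᵖ N] (f f' : M →ₗ[Λᵐᵒᵖ] N) (r : k)
    (h : ∀ m, f' m = op (algebraMap k Λ r) • f m) (x : SkewTensor Λ G M) :
    (TensorMod.map _ f' x : SkewTensor Λ G N) =
      op (algebraMap k (SkewGroupAlgebra Λ G) r) • TensorMod.map _ f x := by
  induction x using TensorMod.induction with
  | h0 => rw [map_zero, map_zero, smul_zero]
  | h2 x y hx hy => rw [map_add, map_add, smul_add, hx, hy]
  | h1 m b =>
    rw [TensorMod.map_mk, TensorMod.map_mk, h, TensorMod.mk_smul, TensorMod.op_smul_mk,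
      ← Algebra.commutes]
    rfl

variable [Module.Finite k Λ] [Finite G]

instance (N : FMod k (SkewGroupAlgebra Λ G)) : Module.Finite Λᵐᵒᵖ (RestrictMod Λ G N) :=
  finite_restrictMod k Λ G N

/-- The restriction of scalars `mod ΛG ⥤ mod Λ`. -/
def restrict : FMod k (SkewGroupAlgebra Λ G) ⥤ FMod k Λ where
  obj N := FMod.of k (RestrictMod Λ G N)
  map {M N} f := FMod.hom (M := FMod.of k (RestrictMod Λ G M)) (N := FMod.of k (RestrictMod Λ G N))
    { toFun := fun x ↦ FMod.lin f x
      map_add' := (FMod.lin f).map_add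
      map_smul' := fun a x ↦ (FMod.lin f).map_smul (op (single 1 a.unop)) x }
  map_id _ := FMod.ext fun _ ↦ rfl
  map_comp _ _ := FMod.ext fun _ ↦ rfl

instance : (restrict k Λ G).Additive where
  map_add := FMod.ext fun _ ↦ rfl

instance : PreservesFiniteLimits (restrict k Λ G) :=
  (FMod.preserves _ fun _ _ h ↦ h).1

instance : PreservesFiniteColimits (restrict k Λ G) :=
  (FMod.preserves _ fun _ _ h ↦ h).2

instance : (skewTensor k Λ G).Linear k where
  map_smul f r := FMod.ext fun x ↦
    SkewTensor.map_smul_algebraMap k (FMod.lin f) (FMod.lin (r • f)) r (fun _ ↦ rfl) x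

variable {k Λ G}

theorem FMod.lin_sum {M N : FMod k Λ} {ι : Type*} (s : Finset ι) (f : ι → (M ⟶ N)) (x : M) :
    FMod.lin (∑ i ∈ s, f i) x = ∑ i ∈ s, FMod.lin (f i) x := by
  classical
  induction s using Finset.induction_on with
  | empty => rfl
  | insert i s hi ih =>
    rw [Finset.sum_insert hi, Finset.sum_insert hi, ← ih]
    rfl

variable (k Λ G)

/-- The unit `m ↦ m ⊗ 1` of the adjunction between `- ⊗_Λ ΛG` and the restriction of scalars. -/
def skewUnit : 𝟭 (FMod k Λ) ⟶ skewTensor k Λ G ⋙ restrict k Λ G where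
  app M := FMod.hom (M := M) (N := (restrict k Λ G).obj ((skewTensor k Λ G).obj M))
    (skewUnitLin Λ G M)
  naturality _ _ _ := FMod.ext fun _ ↦ rfl

/-- The counit `n ⊗ b ↦ n b` of the adjunction between `- ⊗_Λ ΛG` and the restriction of
scalars, as a natural transformation. -/
def skewCounit : restrict k Λ G ⋙ skewTensor k Λ G ⟶ 𝟭 (FMod k (SkewGroupAlgebra Λ G)) where
  app N := FMod.hom (M := (skewTensor k Λ G).obj ((restrict k Λ G).obj N)) (N := N)
    (skewCounitLin Λ G N)
  naturality M N f := FMod.ext fun x ↦ by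
    induction x using TensorMod.induction with
    | h0 => exact (map_zero _).trans (map_zero _).symm
    | h1 m b => exact ((FMod.lin f).map_smul (op b) (show M from m)).symm
    | h2 x y hx hy => exact (map_add _ _ _).trans ((congrArg₂ (· + ·) hx hy).trans
        (map_add _ _ _).symm)

/-- The inclusions `M^{g⁻¹} → M ⊗_Λ ΛG`, as a natural transformation. -/
def twistIncl (g : G) : twist k Λ g⁻¹ ⟶ skewTensor k Λ G ⋙ restrict k Λ G where
  app M := FMod.hom (M := (twist k Λ g⁻¹).obj M)
    (N := (restrict k Λ G).obj ((skewTensor k Λ G).obj M)) (twistInclLin Λ G g M)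
  naturality _ _ _ := FMod.ext fun _ ↦ rfl

/-- The projections `M ⊗_Λ ΛG → M^{g⁻¹}`, as a natural transformation. -/
def twistProj (g : G) : skewTensor k Λ G ⋙ restrict k Λ G ⟶ twist k Λ g⁻¹ where
  app M := FMod.hom (N := (twist k Λ g⁻¹).obj M)
    (M := (restrict k Λ G).obj ((skewTensor k Λ G).obj M)) (twistProjLin Λ G g M)
  naturality _ _ f := FMod.ext fun x ↦ SkewTensor.coeff_map (FMod.lin f) g⁻¹ x

/-! ### Relations between natural maps of modules: adjunction, splitting into twists, translations
-/

variable {k Λ G}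

/-- Triangle identity of the adjunction: (m ⊗ 1) b = m ⊗ b. The other triangle is n · 1 = n. -/
theorem skewUnit_counit (M : FMod k Λ) :
    (skewTensor k Λ G).map ((skewUnit k Λ G).app M) ≫
      (skewCounit k Λ G).app ((skewTensor k Λ G).obj M) = 𝟙 _ :=
  FMod.ext fun x ↦ by
    induction x using TensorMod.induction with
    | h0 => exact (map_zero _).trans (map_zero _).symm
    | h1 m b =>
      exact (TensorMod.op_smul_mk _ (M := M) m 1 b).trans (congrArg (TensorMod.mk _ (M := M) m) (one_mul b))
    | h2 x y hx hy => exact (map_add _ _ _).trans ((congrArg₂ (· + ·) hx hy).trans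
        (map_add _ _ _).symm)

theorem skewUnit_counit' (N : FMod k (SkewGroupAlgebra Λ G)) :
    (skewUnit k Λ G).app ((restrict k Λ G).obj N) ≫
      (restrict k Λ G).map ((skewCounit k Λ G).app N) = 𝟙 _ :=
  FMod.ext fun x ↦ one_smul (SkewGroupAlgebra Λ G)ᵐᵒᵖ (show N from x)

/-- Together with `twistIncl_proj_of_ne` and `sum_twistProj_incl`, this exhibits the restriction of
M ⊗_Λ ΛG to Λ as the direct sum of the twists M^{g⁻¹}, naturally in M. It is kept as equations
between maps so that it passes to derived categories. -/
theorem twistIncl_proj (g : G) (M : FMod k Λ) :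
    (twistIncl k Λ G g).app M ≫ (twistProj k Λ G g).app M = 𝟙 _ :=
  FMod.ext fun (x : M) ↦ by
    classical
    change op ((single g⁻¹ (1 : Λ)).coeff g⁻¹) • x = x
    rw [coeff_single_apply, if_pos rfl, op_one, one_smul]

theorem twistIncl_proj_of_ne {g h : G} (e : g ≠ h) (M : FMod k Λ) :
    (twistIncl k Λ G g).app M ≫ (twistProj k Λ G h).app M = 0 :=
  FMod.ext fun (x : M) ↦ by
    classical
    change op ((single g⁻¹ (1 : Λ)).coeff h⁻¹) • x = 0
    rw [coeff_single_apply, if_neg (inv_injective.ne e), MulOpposite.op_zero, zero_smul]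

theorem sum_twistProj_incl [Fintype G] (M : FMod k Λ) :
    ∑ g, (twistProj k Λ G g).app M ≫ (twistIncl k Λ G g).app M = 𝟙 _ :=
  FMod.ext fun x ↦ by
    refine (FMod.lin_sum _ _ x).trans (Eq.trans ?_ (SkewTensor.sum_coeff x))
    -- The summand of index g picks the coefficient at g⁻¹, hence the reindexing by inversion.
    exact Equiv.sum_comp (Equiv.inv G)
      fun g ↦ (TensorMod.mk _ (SkewTensor.coeff g x) (single g 1) : SkewTensor Λ G M)

variable (k Λ) in
/-- The transformation `M^{g⁻¹} ⊗_Λ ΛG → (M ⊗_Λ ΛG) ⊗_Λ ΛG → M ⊗_Λ ΛG`,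
`m ⊗ b ↦ m ⊗ (1 ⊗ g⁻¹) b`. -/
def twistTrans (g : G) : twist k Λ g⁻¹ ⋙ skewTensor k Λ G ⟶ skewTensor k Λ G :=
  Functor.whiskerRight (twistIncl k Λ G g) _ ≫
    Functor.whiskerLeft (skewTensor k Λ G) (skewCounit k Λ G)

/-- Left multiplication by g⁻¹ and then by h⁻¹ is left multiplication by (gh)⁻¹; on M itself nothing
happens, as the identification of the twists is the identity on elements. -/
theorem twistTrans_mul (g h : G) (M : FMod k Λ) :
    (skewTensor k Λ G).map ((twistMul k (Λ := Λ) (mul_inv_rev g h).symm).hom.app M) ≫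
      (twistTrans k Λ g).app ((twist k Λ h⁻¹).obj M) ≫ (twistTrans k Λ h).app M =
      (twistTrans k Λ (g * h)).app M :=
  FMod.ext fun x ↦ by
    induction x using TensorMod.induction with
    | h0 => exact (map_zero _).trans (map_zero _).symm
    | h1 m b =>
      change (TensorMod.mk _ (show M from m) (single h⁻¹ 1 * (single g⁻¹ 1 * b)) :
        SkewTensor Λ G M) = TensorMod.mk _ (show M from m) (single (g * h)⁻¹ 1 * b)
      rw [← mul_assoc, single_mul_single, smul_one, mul_one, mul_inv_rev]
    | h2 x y hx hy => exact (map_add _ _ _).trans ((congrArg₂ (· + ·) hx hy).trans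
        (map_add _ _ _).symm)

/-- The eigenvalue comes from χ(g⁻¹ b) = χ(g⁻¹) g⁻¹ χ(b) in ΛG, since χ is multiplicative on ΛG. -/
theorem twistTrans_char (g : G) (χ : CharGroup k G) (M : FMod k Λ) :
    (twist k (SkewGroupAlgebra Λ G) χ⁻¹).map ((twistTrans k Λ g).app M) ≫
      (charIso Λ χ).hom.app M =
      (χ g⁻¹ : k) • ((charIso Λ χ).hom.app ((twist k Λ g⁻¹).obj M) ≫
        (twistTrans k Λ g).app M) :=
  FMod.ext fun x ↦ by
    induction x using TensorMod.induction with
    | h0 => exact (map_zero _).trans (map_zero _).symm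
    | h1 m b =>
      change (TensorMod.mk _ (show M from m) (χ • (single g⁻¹ 1 * b)) : SkewTensor Λ G M) =
        TensorMod.mk _ (show M from m) ((single g⁻¹ 1 * χ • b) * algebraMap k _ (χ g⁻¹ : k))
      rw [char_smul_mul, char_smul_single, ← Algebra.commutes, ← Algebra.smul_def,
        ← smul_mul_assoc, smul_single]
    | h2 x y hx hy => exact (map_add _ _ _).trans ((congrArg₂ (· + ·) hx hy).trans
        (map_add _ _ _).symm)

end Restrict

/-! ### Associativity and unit laws for composed models -/

section Associativity

variable {C₁ C₂ C₃ C₄ : Type*} [Category* C₁] [Category* C₂] [Category* C₃] [Category* C₄]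
  [Abelian C₁] [Abelian C₂] [Abelian C₃] [Abelian C₄]
  [HasDerivedCategory C₁] [HasDerivedCategory C₂] [HasDerivedCategory C₃] [HasDerivedCategory C₄]

namespace Model.Lifts

/-- The transport principle: an equation between transformations of derived functors follows from
the equation between the maps of complexes below them. -/
theorem ext_of_eq {M N : Model C₁ C₂} {θ₁ θ₂ : M.der ⟶ N.der} {θ₁' θ₂' : M.cx ⟶ N.cx}
    (h₁ : Lifts M N θ₁ θ₁') (h₂ : Lifts M N θ₂ θ₂') (h : θ₁' = θ₂') : θ₁ = θ₂ :=
  h₁.ext (h ▸ h₂)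

/-- The two bracketings have the same functors on derived categories and on complexes; only their
comparison isomorphisms are built differently, and functoriality of `C.der` makes them equal. The
same holds for the units below, so a lifted transformation can change bracketing without changing
itself. -/
theorem assoc_iso (A : Model C₁ C₂) (B : Model C₂ C₃) (C : Model C₃ C₄)
    (K : CochainComplex C₁ ℤ) :
    ((A.comp B).comp C).iso.hom.app K = (A.comp (B.comp C)).iso.hom.app K :=
  (congrArg (· ≫ C.iso.hom.app (B.cx.obj (A.cx.obj K))) (C.der.map_comp
    (B.der.map (A.iso.hom.app K)) (B.iso.hom.app (A.cx.obj K)))).trans (assoc _ _ _)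

theorem id_comp_iso (A : Model C₁ C₂) (K : CochainComplex C₁ ℤ) :
    ((Model.id C₁).comp A).iso.hom.app K = A.iso.hom.app K :=
  (congrArg (· ≫ A.iso.hom.app K) ((congrArg A.der.map (Category.id_comp (𝟙 (Q.obj K)))).trans
    (A.der.map_id (Q.obj K)))).trans (Category.id_comp _)

theorem comp_id_iso (A : Model C₁ C₂) (K : CochainComplex C₁ ℤ) :
    (A.comp (Model.id C₂)).iso.hom.app K = A.iso.hom.app K :=
  (congrArg (A.iso.hom.app K ≫ ·) (Category.id_comp (𝟙 (Q.obj (A.cx.obj K))))).trans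
    (Category.comp_id _)

theorem assoc_target {M : Model C₁ C₄} {A : Model C₁ C₂} {B : Model C₂ C₃} {C : Model C₃ C₄}
    {θ : M.der ⟶ ((A.comp B).comp C).der} {θ' : M.cx ⟶ ((A.comp B).comp C).cx}
    (h : Lifts M ((A.comp B).comp C) θ θ') : Lifts M (A.comp (B.comp C)) θ θ' := fun K ↦
  (congrArg (θ.app (Q.obj K) ≫ ·) (assoc_iso A B C K)).symm.trans (h K)

theorem assoc_source {M : Model C₁ C₄} {A : Model C₁ C₂} {B : Model C₂ C₃} {C : Model C₃ C₄}
    {θ : ((A.comp B).comp C).der ⟶ M.der} {θ' : ((A.comp B).comp C).cx ⟶ M.cx}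
    (h : Lifts ((A.comp B).comp C) M θ θ') : Lifts (A.comp (B.comp C)) M θ θ' := fun K ↦
  (h K).trans (congrArg (· ≫ Q.map (θ'.app K)) (assoc_iso A B C K))

theorem id_comp_source {M A : Model C₁ C₂} {θ : A.der ⟶ M.der} {θ' : A.cx ⟶ M.cx}
    (h : Lifts ((Model.id C₁).comp A) M θ θ') : Lifts A M θ θ' := fun K ↦
  (h K).trans (congrArg (· ≫ Q.map (θ'.app K)) (id_comp_iso A K))

theorem comp_id_source {M A : Model C₁ C₂} {θ : A.der ⟶ M.der} {θ' : A.cx ⟶ M.cx}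
    (h : Lifts (A.comp (Model.id C₂)) M θ θ') : Lifts A M θ θ' := fun K ↦
  (h K).trans (congrArg (· ≫ Q.map (θ'.app K)) (comp_id_iso A K))

theorem id_comp_target {M A : Model C₁ C₂} {θ : M.der ⟶ A.der} {θ' : M.cx ⟶ A.cx}
    (h : Lifts M ((Model.id C₁).comp A) θ θ') : Lifts M A θ θ' := fun K ↦
  (congrArg (θ.app (Q.obj K) ≫ ·) (id_comp_iso A K)).symm.trans (h K)

theorem comp_id_target {M A : Model C₁ C₂} {θ : M.der ⟶ A.der} {θ' : M.cx ⟶ A.cx}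
    (h : Lifts M (A.comp (Model.id C₂)) θ θ') : Lifts M A θ θ' := fun K ↦
  (congrArg (θ.app (Q.obj K) ≫ ·) (comp_id_iso A K)).symm.trans (h K)

end Model.Lifts

end Associativity

/-! ## Transformations of bounded derived functors induced by exact functors -/

section Exact

open Model

variable {C₁ C₂ C₃ : Type*} [Category* C₁] [Category* C₂] [Category* C₃]
  [Abelian C₁] [Abelian C₂] [Abelian C₃]
  [HasDerivedCategory C₁] [HasDerivedCategory C₂] [HasDerivedCategory C₃]

section Defs

variable {F : C₁ ⥤ C₂} [F.Additive] [PreservesFiniteLimits F] [PreservesFiniteColimits F]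
  {H : C₂ ⥤ C₃} [H.Additive] [PreservesFiniteLimits H] [PreservesFiniteColimits H]
  {P : C₁ ⥤ C₃} [P.Additive] [PreservesFiniteLimits P] [PreservesFiniteColimits P]
  {R : C₂ ⥤ C₁} [R.Additive] [PreservesFiniteLimits R] [PreservesFiniteColimits R]

/-- The transformation induced on derived categories by a transformation from a composition of
exact functors. -/
def derivedOut (τ : F ⋙ H ⟶ P) :
    F.mapDerivedCategory ⋙ H.mapDerivedCategory ⟶ P.mapDerivedCategory :=
  (derivedComp F H).inv ≫ derivedTrans τ

/-- The transformation induced on derived categories by a transformation to a composition of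
exact functors. -/
def derivedIn (τ : P ⟶ F ⋙ H) :
    P.mapDerivedCategory ⟶ F.mapDerivedCategory ⋙ H.mapDerivedCategory :=
  derivedTrans τ ≫ (derivedComp F H).hom

/-- The transformation induced on derived categories by a transformation from the identity to a
composition of exact functors. -/
def derivedUnit (η : 𝟭 C₁ ⟶ F ⋙ R) :
    𝟭 (DerivedCategory C₁) ⟶ F.mapDerivedCategory ⋙ R.mapDerivedCategory :=
  lift (Model.id C₁) ((ofExact F).comp (ofExact R)) (NatTrans.mapHomologicalComplex η _)

/-- The transformation induced on derived categories by a transformation from a composition of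
exact functors to the identity. -/
def derivedCounit (ε : R ⋙ F ⟶ 𝟭 C₂) :
    R.mapDerivedCategory ⋙ F.mapDerivedCategory ⟶ 𝟭 (DerivedCategory C₂) :=
  lift ((ofExact R).comp (ofExact F)) (Model.id C₂) (NatTrans.mapHomologicalComplex ε _)

theorem lifts_derivedOut (τ : F ⋙ H ⟶ P) :
    Lifts ((ofExact F).comp (ofExact H)) (ofExact P) (derivedOut τ)
      (NatTrans.mapHomologicalComplex τ _) :=
  (id_comp (NatTrans.mapHomologicalComplex τ (ComplexShape.up ℤ))) ▸
    (Lifts.derivedComp_inv F H).comp (Lifts.derivedTrans τ)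

theorem lifts_derivedIn (τ : P ⟶ F ⋙ H) :
    Lifts (ofExact P) ((ofExact F).comp (ofExact H)) (derivedIn τ)
      (NatTrans.mapHomologicalComplex τ _) :=
  (comp_id (NatTrans.mapHomologicalComplex τ (ComplexShape.up ℤ))) ▸
    (Lifts.derivedTrans τ).comp (Lifts.derivedComp F H)

theorem lifts_derivedUnit (η : 𝟭 C₁ ⟶ F ⋙ R) :
    Lifts (Model.id C₁) ((ofExact F).comp (ofExact R)) (derivedUnit η)
      (NatTrans.mapHomologicalComplex η _) := lifts_lift _ _ _

theorem lifts_derivedCounit (ε : R ⋙ F ⟶ 𝟭 C₂) :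
    Lifts ((ofExact R).comp (ofExact F)) (Model.id C₂) (derivedCounit ε)
      (NatTrans.mapHomologicalComplex ε _) := lifts_lift _ _ _

end Defs

section Relations

variable {F : C₁ ⥤ C₂} [F.Additive] [PreservesFiniteLimits F] [PreservesFiniteColimits F]
  {R : C₂ ⥤ C₁} [R.Additive] [PreservesFiniteLimits R] [PreservesFiniteColimits R]
  {T : C₁ ⥤ C₁} [T.Additive] [PreservesFiniteLimits T] [PreservesFiniteColimits T]
  {T' : C₁ ⥤ C₁} [T'.Additive] [PreservesFiniteLimits T'] [PreservesFiniteColimits T']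
  {W : C₁ ⥤ C₁} [W.Additive] [PreservesFiniteLimits W] [PreservesFiniteColimits W]
  {S : C₂ ⥤ C₂} [S.Additive] [PreservesFiniteLimits S] [PreservesFiniteColimits S]
  {η : 𝟭 C₁ ⟶ F ⋙ R} {ε : R ⋙ F ⟶ 𝟭 C₂}

/-- Each side is lifted from complexes by whiskering and composing, so only the hypothesis in each
degree has to be checked. The other relations of this section follow the same pattern. -/
theorem derivedUnit_counit (h : ∀ M, F.map (η.app M) ≫ ε.app (F.obj M) = 𝟙 _)
    (X : DerivedCategory C₁) :
    F.mapDerivedCategory.map ((derivedUnit η).app X) ≫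
      (derivedCounit ε).app (F.mapDerivedCategory.obj X) = 𝟙 _ := by
  refine congr_app (Lifts.ext_of_eq
    (((lifts_derivedUnit η).whiskerRight (ofExact F)).id_comp_source.assoc_target.comp
      ((lifts_derivedCounit ε).whiskerLeft (ofExact F)).comp_id_target)
    (Lifts.id (ofExact F)) ?_) X
  ext K n : 3
  exact h (K.X n)

theorem derivedUnit_counit' (h : ∀ M, η.app (R.obj M) ≫ R.map (ε.app M) = 𝟙 _)
    (X : DerivedCategory C₂) :
    (derivedUnit η).app (R.mapDerivedCategory.obj X) ≫
      R.mapDerivedCategory.map ((derivedCounit ε).app X) = 𝟙 _ := by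
  refine congr_app (Lifts.ext_of_eq
    (((lifts_derivedUnit η).whiskerLeft (ofExact R)).comp_id_source.comp
      ((lifts_derivedCounit ε).whiskerRight (ofExact R)).assoc_source.id_comp_target)
    (Lifts.id (ofExact R)) ?_) X
  ext K n : 3
  exact h (K.X n)

theorem derivedOut_eq (i : T ⟶ F ⋙ R) (b : T ⋙ F ⟶ F)
    (h : ∀ M, b.app M = F.map (i.app M) ≫ ε.app (F.obj M)) (X : DerivedCategory C₁) :
    (derivedOut b).app X = F.mapDerivedCategory.map ((derivedIn i).app X) ≫
      (derivedCounit ε).app (F.mapDerivedCategory.obj X) := by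
  refine congr_app (Lifts.ext_of_eq (lifts_derivedOut b)
    (((lifts_derivedIn i).whiskerRight (ofExact F)).assoc_target.comp
      ((lifts_derivedCounit ε).whiskerLeft (ofExact F)).comp_id_target) ?_) X
  ext K n : 3
  exact h (K.X n)

theorem derivedIn_out (i : T ⟶ F ⋙ R) (p : F ⋙ R ⟶ T)
    (h : ∀ M, i.app M ≫ p.app M = 𝟙 _) (X : DerivedCategory C₁) :
    (derivedIn i).app X ≫ (derivedOut p).app X = 𝟙 _ := by
  refine congr_app (Lifts.ext_of_eq ((lifts_derivedIn i).comp (lifts_derivedOut p))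
    (Lifts.id (ofExact T)) ?_) X
  ext K n : 3
  exact h (K.X n)

theorem derivedIn_out_zero (i : T ⟶ F ⋙ R) (p : F ⋙ R ⟶ T')
    (h : ∀ M, i.app M ≫ p.app M = 0) (X : DerivedCategory C₁) :
    (derivedIn i).app X ≫ (derivedOut p).app X = 0 := by
  refine congr_app (Lifts.ext_of_eq ((lifts_derivedIn i).comp (lifts_derivedOut p))
    Lifts.zero ?_) X
  ext K n : 3
  exact h (K.X n)

theorem sum_derivedOut_in {ι : Type*} [Fintype ι] {T : ι → C₁ ⥤ C₁} [∀ g, (T g).Additive]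
    [∀ g, PreservesFiniteLimits (T g)] [∀ g, PreservesFiniteColimits (T g)]
    (i : ∀ g, T g ⟶ F ⋙ R) (p : ∀ g, F ⋙ R ⟶ T g)
    (h : ∀ M, ∑ g, (p g).app M ≫ (i g).app M = 𝟙 _) (X : DerivedCategory C₁) :
    ∑ g, (derivedOut (p g)).app X ≫ (derivedIn (i g)).app X = 𝟙 _ := by
  have := congr_app (Lifts.ext_of_eq (Lifts.sum Finset.univ fun g ↦
    (lifts_derivedOut (p g)).comp (lifts_derivedIn (i g)))
    (Lifts.id ((ofExact F).comp (ofExact R))) ?_) X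
  · rw [NatTrans.app_sum] at this
    exact this
  · ext K n : 3
    rw [NatTrans.app_sum]
    -- Taking the component in degree n is additive, so it passes inside the sum.
    exact (_root_.map_sum (HomologicalComplex.Hom.fAddMonoidHom
      (C₁ := ((ofExact F).comp (ofExact R)).cx.obj K)
      (C₂ := ((ofExact F).comp (ofExact R)).cx.obj K) n) _ _).trans (h (K.X n))

/-- Transports `twistTrans_mul`, with m the identification of a twist by a product with a double
twist. -/
theorem derivedOut_mul (m : W ⟶ T ⋙ T') (b : T ⋙ F ⟶ F) (b' : T' ⋙ F ⟶ F) (c : W ⋙ F ⟶ F)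
    (h : ∀ M, F.map (m.app M) ≫ b'.app (T.obj M) ≫ b.app M = c.app M)
    (X : DerivedCategory C₁) :
    F.mapDerivedCategory.map ((derivedIn m).app X) ≫
      (derivedOut b').app (T.mapDerivedCategory.obj X) ≫ (derivedOut b).app X =
      (derivedOut c).app X := by
  refine congr_app (Lifts.ext_of_eq
    (((lifts_derivedIn m).whiskerRight (ofExact F)).assoc_target.comp
      (((lifts_derivedOut b').whiskerLeft (ofExact T)).comp (lifts_derivedOut b)))
    (lifts_derivedOut c) ?_) X
  ext K n : 3
  exact h (K.X n)

/-- Transports `twistTrans_char`, with S the twist by χ⁻¹, s the character isomorphism and r its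
eigenvalue. -/
theorem derivedOut_smul {A : Type*} [CommRing A] [Linear A C₁] [Linear A C₂] (r : A)
    (b : T ⋙ F ⟶ F) (s : F ⋙ S ⟶ F)
    (h : ∀ M, S.map (b.app M) ≫ s.app M = r • (s.app (T.obj M) ≫ b.app M))
    (X : DerivedCategory C₁) :
    S.mapDerivedCategory.map ((derivedOut b).app X) ≫ (derivedOut s).app X =
      r • ((derivedOut s).app (T.mapDerivedCategory.obj X) ≫ (derivedOut b).app X) := by
  refine congr_app (Lifts.ext_of_eq
    (((lifts_derivedOut b).whiskerRight (ofExact S)).comp (lifts_derivedOut s)).assoc_source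
    (Lifts.smul r (((lifts_derivedOut s).whiskerLeft (ofExact T)).comp (lifts_derivedOut b)))
      ?_) X
  ext K n : 3
  exact h (K.X n)

end Relations

end Exact

/-! ## Maps between objects induced along an adjunction -/

section Adjoint

/-- The relations on i and p make R(F Y) the biproduct of the Z g. The transpose X → R(F Y) of φ is
therefore the same as a family of components X → Z g, and the sum is this family transposed back. -/
theorem existsUnique_sum_of_adjunction {C C' : Type*} [Category* C] [Category* C']
    [Preadditive C] [Preadditive C'] {F : C ⥤ C'} [F.Additive] {R : C' ⥤ C} (adj : F ⊣ R)
    {ι : Type*} [Fintype ι] {X Y : C} {Z : ι → C} (i : ∀ g, Z g ⟶ R.obj (F.obj Y))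
    (p : ∀ g, R.obj (F.obj Y) ⟶ Z g) (hip : ∀ g, i g ≫ p g = 𝟙 _)
    (hip' : ∀ g h, g ≠ h → i g ≫ p h = 0) (hpi : ∑ g, p g ≫ i g = 𝟙 _)
    (φ : F.obj X ⟶ F.obj Y) :
    ∃! ψ : ∀ g, X ⟶ Z g, φ = ∑ g, F.map (ψ g) ≫ F.map (i g) ≫ adj.counit.app (F.obj Y) := by
  have key (ψ : ∀ g, X ⟶ Z g) :
      ∑ g, F.map (ψ g) ≫ F.map (i g) ≫ adj.counit.app (F.obj Y) =
        (adj.homEquiv X (F.obj Y)).symm (∑ g, ψ g ≫ i g) := by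
    simp only [Adjunction.homEquiv_counit, F.map_sum, Preadditive.sum_comp, F.map_comp, assoc]
  refine ⟨fun g ↦ adj.homEquiv _ _ φ ≫ p g, ?_, fun ψ hψ ↦ funext fun h ↦ ?_⟩
  -- The family is found by projecting the transpose of φ to each Z g.
  · change φ = _
    rw [key]
    simp only [assoc, ← Preadditive.comp_sum, hpi, comp_id, Equiv.symm_apply_apply]
  · change φ = _ at hψ
    classical
    rw [hψ, key, Equiv.apply_symm_apply, Preadditive.sum_comp, Finset.sum_eq_single h]
    · rw [assoc, hip, comp_id]
    · intro g _ hg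
      rw [assoc, hip' g h hg, comp_zero]
    · simp

end Adjoint

/-! ## A criterion for being a skew group algebra -/

section Criterion

open SkewMonoidAlgebra

variable {k : Type*} [Field k] {G : Type*} [Group G] {A B : Type*} [Ring A] [Ring B]
  [Algebra k A] [Algebra k B] [MulSemiringAction G A] [SMulCommClass G k A]

/-- The first two relations are those of the skew group algebra, so φ and w extend to an algebra
map. The third says that the w g form a basis of B as a left A-module: existence of coefficients is
surjectivity and uniqueness is injectivity. -/
theorem exists_algEquiv_skewMonoidAlgebra [Fintype G] (φ : A →ₐ[k] B) (w : G → B)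
    (hw : ∀ g h, w (g * h) = w g * w h) (hc : ∀ g a, φ (g • a) * w g = w g * φ a)
    (hb : ∀ b, ∃! f : G → A, b = ∑ g, φ (f g) * w g) :
    ∃ Φ : SkewMonoidAlgebra A G ≃ₐ[k] B, ∀ g a, Φ (single g a) = φ a * w g := by
  have h1 : w 1 = 1 := by
    -- Expand 1 in the basis; right multiplication by w 1 fixes each w g, hence fixes 1.
    obtain ⟨f, hf, -⟩ := hb 1
    have : (1 : B) * w 1 = 1 := by
      change (1 : B) = _ at hf
      conv_rhs => rw [hf]
      conv_lhs => rw [hf]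
      rw [Finset.sum_mul]
      refine Finset.sum_congr rfl fun g _ ↦ ?_
      rw [mul_assoc, ← hw, mul_one]
    rwa [one_mul] at this
  let W : G →* B := { toFun := w, map_one' := h1, map_mul' := hw }
  let Φ : SkewMonoidAlgebra A G →ₐ[k] B := liftNCAlgHom φ W fun {a g} ↦ hc g a
  have hΦ (g : G) (a : A) : Φ (single g a) = φ a * w g := liftNC_single _ _ _ _
  have hsum (x : SkewMonoidAlgebra A G) : Φ x = ∑ g, φ (x.coeff g) * w g := by
    classical
    induction x using SkewMonoidAlgebra.induction_on with
    | zero => simp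
    | add x y hx hy => simp [hx, hy, add_mul, Finset.sum_add_distrib]
    | single g a =>
      rw [hΦ, Finset.sum_eq_single g]
      · rw [coeff_single_apply, if_pos rfl]
      · intro h _ hg
        rw [coeff_single_apply, if_neg hg.symm, map_zero, zero_mul]
      · simp
  refine ⟨AlgEquiv.ofBijective Φ ⟨fun x y hxy ↦ ?_, fun b ↦ ?_⟩, hΦ⟩
  · refine SkewMonoidAlgebra.ext fun g ↦ ?_
    exact congrFun ((hb (Φ x)).unique (hsum x) (hxy.trans (hsum y))) g
  · obtain ⟨f, hf, -⟩ := hb b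
    refine ⟨⟨Finsupp.equivFunOnFinite.symm f⟩, ?_⟩
    rw [hsum]
    exact hf.symm

/-- Equivariance only has to be seen on a ⊗ g, where χ fixes the first factor of the image and
scales the second. -/
theorem map_char_smul [MulSemiringAction (CharGroup k G) B] (φ : A →ₐ[k] B) (w : G → B)
    (Φ : SkewMonoidAlgebra A G →ₐ[k] B) (hΦ : ∀ g a, Φ (single g a) = φ a * w g)
    (χ : CharGroup k G) (hφ : ∀ a, χ • φ a = φ a) (hχ : ∀ g, χ • w g = (χ g : k) • w g)
    (x : SkewMonoidAlgebra A G) : Φ (χ • x) = χ • Φ x := by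
  induction x using SkewMonoidAlgebra.induction_on with
  | zero => rw [smul_zero, map_zero, smul_zero]
  | add x y hx hy => rw [smul_add, map_add, map_add, smul_add, hx, hy]
  | single g a =>
    rw [char_smul_single, hΦ, hΦ, smul_mul', hφ, hχ, map_smul, smul_mul_assoc, mul_smul_comm]

end Criterion

/-! ### Passage to bounded derived categories -/

section Bounded

variable {C₁ C₂ : Type*} [Category* C₁] [Category* C₂] [Abelian C₁] [Abelian C₂]
  [HasDerivedCategory C₁] [HasDerivedCategory C₂]

/-- A transformation between functors of bounded derived categories, from one between the
associated functors to the derived category. -/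
def boundedTrans {A B : Bounded C₁ ⥤ Bounded C₂} (θ : A ⋙ Bounded.ι ⟶ B ⋙ Bounded.ι) : A ⟶ B where
  app X := ⟨θ.app X⟩
  naturality _ _ f := ObjectProperty.hom_ext _ (θ.naturality f)

variable {F : C₁ ⥤ C₂} [F.Additive] [PreservesFiniteLimits F] [PreservesFiniteColimits F]
  {R : C₂ ⥤ C₁} [R.Additive] [PreservesFiniteLimits R] [PreservesFiniteColimits R]

/-- The adjunction on bounded derived categories induced by an adjunction between exact
functors. -/
def boundedAdjunction (η : 𝟭 C₁ ⟶ F ⋙ R) (ε : R ⋙ F ⟶ 𝟭 C₂)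
    (h : ∀ M, F.map (η.app M) ≫ ε.app (F.obj M) = 𝟙 _)
    (h' : ∀ M, η.app (R.obj M) ≫ R.map (ε.app M) = 𝟙 _) : mapBounded F ⊣ mapBounded R :=
  Adjunction.mkOfUnitCounit
    { unit := boundedTrans (Functor.whiskerLeft Bounded.ι (derivedUnit η))
      counit := boundedTrans (Functor.whiskerLeft Bounded.ι (derivedCounit ε))
      left_triangle := by
        ext X
        -- The middle factor of the triangle is a component of the associator, an identity.
        exact (congrArg (F.mapDerivedCategory.map ((derivedUnit η).app X.obj) ≫ ·)
          (id_comp _)).trans (derivedUnit_counit h X.obj)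
      right_triangle := by
        ext X
        exact (congrArg ((derivedUnit η).app (R.mapDerivedCategory.obj X.obj) ≫ ·)
          (id_comp _)).trans (derivedUnit_counit' h' X.obj) }

end Bounded

/-! ## The endomorphism algebra of `X ⊗^L_Λ ΛG` -/

section Main

/-- Composing with the isomorphism ι_g turns this map into the action of g on endomorphisms, which
is bijective because G is a group. It identifies Hom(X, X^{g⁻¹}) with End(X). -/
theorem bijective_inv_comp_map {k : Type u} [Field k] {Λ : Type u} [Ring Λ] [Algebra k Λ]
    [Module.Finite k Λ] {G : Type u} [Group G] [MulSemiringAction G Λ] [SMulCommClass G k Λ]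
    {X : Db k Λ} (I : Invariant G X) (g : G) : Function.Bijective
    (fun f : X ⟶ X ↦ (I.ι g).inv ≫ (twistDb k Λ g⁻¹).map f) := by
  have h : Function.Bijective (fun f : EndAlg I ↦ g • f) := MulAction.bijective g
  refine ⟨fun f f' e ↦ h.1 ?_, fun ψ ↦ ?_⟩
  · exact (assoc _ _ _).symm.trans ((congrArg (· ≫ (I.ι g).hom) e).trans (assoc _ _ _))
  · obtain ⟨f, hf⟩ := h.2 (ψ ≫ (I.ι g).hom : X ⟶ X)
    exact ⟨f, (cancel_mono (I.ι g).hom).1 ((assoc _ _ _).trans hf)⟩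

variable (k : Type u) [Field k] (Λ : Type u) [Ring Λ] [Algebra k Λ] [Module.Finite k Λ]
  (G : Type u) [Group G] [Finite G] [MulSemiringAction G Λ] [SMulCommClass G k Λ]

instance : (skewTensorDb k Λ G).Additive := inferInstanceAs (mapBounded _).Additive

instance : (skewTensorDb k Λ G).Linear k := inferInstanceAs ((mapBounded _).Linear k)

/-- The restriction of scalars on bounded derived categories. -/
def restrictDb : Db k (SkewGroupAlgebra Λ G) ⥤ Db k Λ := mapBounded (restrict k Λ G)

/-- The adjunction between `- ⊗^L_Λ ΛG` and the restriction of scalars. -/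
def skewAdjunction : skewTensorDb k Λ G ⊣ restrictDb k Λ G :=
  boundedAdjunction (skewUnit k Λ G) (skewCounit k Λ G) skewUnit_counit skewUnit_counit'

variable {G}

/-- The inclusions `X^{g⁻¹} → X ⊗^L_Λ ΛG` in the bounded derived category of `Λ`. -/
def twistInclDb (g : G) : twistDb k Λ g⁻¹ ⟶ skewTensorDb k Λ G ⋙ restrictDb k Λ G :=
  boundedTrans (Functor.whiskerLeft Bounded.ι (derivedIn (twistIncl k Λ G g)))

/-- The projections `X ⊗^L_Λ ΛG → X^{g⁻¹}` in the bounded derived category of `Λ`. -/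
def twistProjDb (g : G) : skewTensorDb k Λ G ⋙ restrictDb k Λ G ⟶ twistDb k Λ g⁻¹ :=
  boundedTrans (Functor.whiskerLeft Bounded.ι (derivedOut (twistProj k Λ G g)))

/-- The transformation `X^{g⁻¹} ⊗^L_Λ ΛG → X ⊗^L_Λ ΛG` induced by `m ⊗ b ↦ m ⊗ (1 ⊗ g⁻¹) b`. -/
def twistTransDb (g : G) : twistDb k Λ g⁻¹ ⋙ skewTensorDb k Λ G ⟶ skewTensorDb k Λ G :=
  boundedTrans (Functor.whiskerLeft Bounded.ι (derivedOut (twistTrans k Λ g)))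

variable {k Λ}

/-- Says that the translation is the transpose under the adjunction of the inclusion of the summand
X^{g⁻¹}. This links the multiplicative description to the direct sum decomposition. -/
theorem twistTransDb_eq (g : G) (X : Db k Λ) :
    (twistTransDb k Λ g).app X = (skewTensorDb k Λ G).map ((twistInclDb k Λ g).app X) ≫
      (skewAdjunction k Λ G).counit.app ((skewTensorDb k Λ G).obj X) :=
  ObjectProperty.hom_ext _ (derivedOut_eq (ε := skewCounit k Λ G) (twistIncl k Λ G g)
    (twistTrans k Λ g) (fun _ ↦ rfl) X.obj)

theorem twistInclDb_projDb (g : G) (X : Db k Λ) :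
    (twistInclDb k Λ g).app X ≫ (twistProjDb k Λ g).app X = 𝟙 _ :=
  ObjectProperty.hom_ext _ (derivedIn_out (twistIncl k Λ G g) (twistProj k Λ G g)
    (twistIncl_proj g) X.obj)

theorem twistInclDb_projDb_of_ne {g h : G} (e : g ≠ h) (X : Db k Λ) :
    (twistInclDb k Λ g).app X ≫ (twistProjDb k Λ h).app X = 0 :=
  ObjectProperty.hom_ext _ (derivedIn_out_zero (twistIncl k Λ G g) (twistProj k Λ G h)
    (twistIncl_proj_of_ne e) X.obj)

theorem sum_twistProjDb_inclDb [Fintype G] (X : Db k Λ) :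
    ∑ g : G, (twistProjDb k Λ g).app X ≫ (twistInclDb k Λ g).app X = 𝟙 _ := by
  refine ObjectProperty.hom_ext _ (Eq.trans ?_ (sum_derivedOut_in (fun g ↦ twistIncl k Λ G g)
    (fun g ↦ twistProj k Λ G g) sum_twistProj_incl X.obj))
  exact (Bounded.ι (C := FMod k Λ)).map_sum _ _

theorem twistTransDb_mul (g h : G) (X : Db k Λ) :
    (skewTensorDb k Λ G).map ((twistDbMul k Λ (mul_inv_rev g h).symm).hom.app X) ≫
      (twistTransDb k Λ g).app ((twistDb k Λ h⁻¹).obj X) ≫ (twistTransDb k Λ h).app X =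
      (twistTransDb k Λ (g * h)).app X :=
  ObjectProperty.hom_ext _ (derivedOut_mul (twistMul k (Λ := Λ) (mul_inv_rev g h).symm).hom
    (twistTrans k Λ h) (twistTrans k Λ g) (twistTrans k Λ (g * h)) (twistTrans_mul g h) X.obj)

theorem twistTransDb_char (g : G) (χ : CharGroup k G) (X : Db k Λ) :
    (twistDb k (SkewGroupAlgebra Λ G) χ⁻¹).map ((twistTransDb k Λ g).app X) ≫
      (charIsoDb Λ χ).hom.app X =
      (χ g⁻¹ : k) • ((charIsoDb Λ χ).hom.app ((twistDb k Λ g⁻¹).obj X) ≫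
        (twistTransDb k Λ g).app X) :=
  ObjectProperty.hom_ext _ (derivedOut_smul (χ g⁻¹ : k) (twistTrans k Λ g) (charIso Λ χ).hom
    (twistTrans_char g χ) X.obj)

/-! ### Translations of the induced object and the expansion of its endomorphisms -/

variable {X : Db k Λ} (I : Invariant G X)

/-- The endomorphism of `X ⊗^L_Λ ΛG` given by `m ⊗ b ↦ ι_g⁻¹(m) ⊗ (1 ⊗ g⁻¹) b`. -/
def translate (g : G) : (skewTensorDb k Λ G).obj X ⟶ (skewTensorDb k Λ G).obj X :=
  (skewTensorDb k Λ G).map (I.ι g).inv ≫ (twistTransDb k Λ g).app X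

/-- Inverting the cocycle condition writes ι_{gh}⁻¹ through ι_g⁻¹ and a twist of ι_h⁻¹; naturality
moves the latter past the translation by g, and `twistTransDb_mul` joins the two translations. -/
theorem translate_mul (g h : G) : translate I (g * h) = translate I g ≫ translate I h := by
  have e : (I.ι (g * h)).inv ≫ (twistDbMul k Λ (mul_inv_rev g h).symm).hom.app X =
      (I.ι g).inv ≫ (twistDb k Λ g⁻¹).map (I.ι h).inv := by
    rw [Iso.inv_comp_eq, I.ι_mul]
    have e' : (twistDb k Λ g⁻¹).map (I.ι h).hom ≫ (twistDb k Λ g⁻¹).map (I.ι h).inv = 𝟙 _ := by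
      rw [← Functor.map_comp, Iso.hom_inv_id, CategoryTheory.Functor.map_id]
    simp only [assoc, Iso.hom_inv_id_assoc, e']
    exact (comp_id _).symm
  have n := (twistTransDb k Λ g).naturality (I.ι h).inv
  have e₂ := congrArg (skewTensorDb k Λ G).map e
  rw [Functor.map_comp, Functor.map_comp] at e₂
  rw [translate, ← twistTransDb_mul, reassoc_of% e₂, translate, translate, assoc]
  exact congrArg ((skewTensorDb k Λ G).map (I.ι g).inv ≫ ·) ((reassoc_of% n) _)

/-- The factor ι_g of g.f cancels against the ι_g⁻¹ in the translation, and naturality turns the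
remaining f^{g⁻¹} into f. This is the commutation relation of the skew group algebra. -/
theorem map_comp_translate (g : G) (f : X ⟶ X) :
    (skewTensorDb k Λ G).map ((I.ι g).inv ≫ (twistDb k Λ g⁻¹).map f ≫ (I.ι g).hom) ≫
      translate I g = translate I g ≫ (skewTensorDb k Λ G).map f := by
  have n := (twistTransDb k Λ g).naturality f
  have e : ((I.ι g).inv ≫ (twistDb k Λ g⁻¹).map f ≫ (I.ι g).hom) ≫ (I.ι g).inv =
      (I.ι g).inv ≫ (twistDb k Λ g⁻¹).map f := by
    simp only [assoc, Iso.hom_inv_id, comp_id]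
  have e' : (skewTensorDb k Λ G).map ((I.ι g).inv ≫ (twistDb k Λ g⁻¹).map f ≫ (I.ι g).hom) ≫
      (skewTensorDb k Λ G).map (I.ι g).inv = (skewTensorDb k Λ G).map (I.ι g).inv ≫
        (skewTensorDb k Λ G).map ((twistDb k Λ g⁻¹).map f) := by
    rw [← Functor.map_comp, e, Functor.map_comp]
  rw [translate, reassoc_of% e', assoc]
  exact congrArg ((skewTensorDb k Λ G).map (I.ι g).inv ≫ ·) n

/-- Naturality brings f in front of the translation, which gives the form of a summand in
`existsUnique_sum_of_adjunction`: the component X → X^{g⁻¹} is f^{g⁻¹} ∘ ι_g⁻¹. -/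
theorem translate_comp_map (g : G) (f : X ⟶ X) :
    translate I g ≫ (skewTensorDb k Λ G).map f =
      (skewTensorDb k Λ G).map ((I.ι g).inv ≫ (twistDb k Λ g⁻¹).map f) ≫
        (skewTensorDb k Λ G).map ((twistInclDb k Λ g).app X) ≫
          (skewAdjunction k Λ G).counit.app ((skewTensorDb k Λ G).obj X) := by
  have n := (twistTransDb k Λ g).naturality f
  rw [← twistTransDb_eq, translate, assoc, Functor.map_comp, assoc]
  exact congrArg ((skewTensorDb k Λ G).map (I.ι g).inv ≫ ·) n.symm

theorem translate_char (g : G) (χ : CharGroup k G) :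
    (charIsoDb Λ χ).inv.app X ≫ (twistDb k (SkewGroupAlgebra Λ G) χ⁻¹).map (translate I g) ≫
      (charIsoDb Λ χ).hom.app X = (χ g⁻¹ : k) • translate I g := by
  have n := (charIsoDb Λ χ).hom.naturality (I.ι g).inv
  have e : (twistDb k (SkewGroupAlgebra Λ G) χ⁻¹).map (translate I g) ≫
      (charIsoDb Λ χ).hom.app X = (charIsoDb Λ χ).hom.app X ≫ ((χ g⁻¹ : k) • translate I g) := by
    rw [translate, Functor.map_comp, assoc, twistTransDb_char, Linear.comp_smul,
      Linear.comp_smul]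
    exact congrArg ((χ g⁻¹ : k) • ·) ((reassoc_of% n) _)
  rw [e, Iso.inv_hom_id_app_assoc]

theorem map_char (f : X ⟶ X) (χ : CharGroup k G) :
    (charIsoDb Λ χ).inv.app X ≫
      (twistDb k (SkewGroupAlgebra Λ G) χ⁻¹).map ((skewTensorDb k Λ G).map f) ≫
      (charIsoDb Λ χ).hom.app X = (skewTensorDb k Λ G).map f :=
  (congrArg ((charIsoDb Λ χ).inv.app X ≫ ·) ((charIsoDb Λ χ).hom.naturality f)).trans
    (Iso.inv_hom_id_app_assoc ..)

theorem existsUnique_sum_translate [Fintype G]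
    (φ : (skewTensorDb k Λ G).obj X ⟶ (skewTensorDb k Λ G).obj X) :
    ∃! f : G → (X ⟶ X), φ = ∑ g, translate I g⁻¹ ≫ (skewTensorDb k Λ G).map (f g) := by
  obtain ⟨ψ, hψ, huniq⟩ := existsUnique_sum_of_adjunction (skewAdjunction k Λ G) (X := X) (Y := X)
    (fun g : G ↦ (twistInclDb k Λ g).app X) (fun g ↦ (twistProjDb k Λ g).app X)
    (fun g ↦ twistInclDb_projDb g X) (fun _ _ h ↦ twistInclDb_projDb_of_ne h X)
    (sum_twistProjDb_inclDb X) φ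
  -- The basis is indexed by g⁻¹ and the summands of the decomposition by g, so the coefficients are
  -- reindexed by inversion.
  have hsum (f : G → (X ⟶ X)) : ∑ g, translate I g⁻¹ ≫ (skewTensorDb k Λ G).map (f g) =
      ∑ g, translate I g ≫ (skewTensorDb k Λ G).map (f g⁻¹) :=
    (Equiv.sum_comp (Equiv.inv G) fun g ↦
      translate I g⁻¹ ≫ (skewTensorDb k Λ G).map (f g)).symm.trans
      (Finset.sum_congr rfl fun g _ ↦ by rw [Equiv.inv_apply, inv_inv])
  -- Each component X → X^{g⁻¹} comes from an endomorphism of X.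
  choose f hf using fun g ↦ (bijective_inv_comp_map I g).2 (ψ g)
  refine ⟨fun g ↦ f g⁻¹, ?_, fun f' hf' ↦ funext fun g ↦ (bijective_inv_comp_map I g⁻¹).1 ?_⟩
  · refine hψ.trans (Eq.trans (Finset.sum_congr rfl fun g _ ↦ ?_) (hsum _).symm)
    rw [translate_comp_map, inv_inv, ← hf g]
  · have := huniq (fun g ↦ (I.ι g).inv ≫ (twistDb k Λ g⁻¹).map (f' g⁻¹))
      (hf'.trans ((hsum f').trans (Finset.sum_congr rfl fun g _ ↦ translate_comp_map I g _)))
    refine Eq.trans ?_ ((congrFun this g⁻¹).trans (hf g⁻¹).symm)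
    exact congrArg (fun f : X ⟶ X ↦ (I.ι g⁻¹).inv ≫ (twistDb k Λ g⁻¹⁻¹).map f)
      (congrArg f' (inv_inv g).symm)

/-- The functor `- ⊗^L_Λ ΛG` on the endomorphism algebra of `X`. -/
def endMap : EndAlg I →ₐ[k] EndAlg (inducedInvariant (G := G) X) where
  toFun f := (skewTensorDb k Λ G).map f
  map_one' := (skewTensorDb k Λ G).map_id X
  map_mul' f f' := (skewTensorDb k Λ G).map_comp f' f
  map_zero' := (skewTensorDb k Λ G).map_zero X X
  map_add' f f' := (skewTensorDb k Λ G).map_add (f := f) (g := f')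
  commutes' r := ((skewTensorDb k Λ G).map_smul r (𝟙 X)).trans
    (congrArg (fun f : (skewTensorDb k Λ G).obj X ⟶ _ ↦ r • f) ((skewTensorDb k Λ G).map_id X))

theorem exists_algEquiv_end :
    ∃ Φ : SkewGroupAlgebra (EndAlg I) G ≃ₐ[k] EndAlg (inducedInvariant (G := G) X),
      ∀ (χ : CharGroup k G) (a : SkewGroupAlgebra (EndAlg I) G), Φ (χ • a) = χ • Φ a := by
  have := Fintype.ofFinite G
  -- Translations multiply in diagrammatic order, opposite to the product of the endomorphism
  -- algebra; the inverse restores the order and makes χ scale w g by χ(g).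
  let w (g : G) : EndAlg (inducedInvariant (G := G) X) := translate I g⁻¹
  obtain ⟨Φ, hΦ⟩ := exists_algEquiv_skewMonoidAlgebra (endMap I) w
    (fun g h ↦ (congrArg (translate I) (mul_inv_rev g h)).trans (translate_mul I h⁻¹ g⁻¹))
    (fun g f ↦ by
      have h := map_comp_translate I g⁻¹ (g • f : EndAlg I)
      -- The left side is the action of g⁻¹ on g.f, written out.
      have e : ((I.ι g⁻¹).inv ≫ (twistDb k Λ g⁻¹⁻¹).map (g • f : EndAlg I) ≫ (I.ι g⁻¹).hom : X ⟶ X) =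
        f := inv_smul_smul g f
      rw [e] at h
      exact h.symm)
    (existsUnique_sum_translate I)
  refine ⟨Φ, fun χ x ↦ map_char_smul (endMap I) w Φ.toAlgHom hΦ χ (fun f ↦ map_char f χ)
    (fun g ↦ ?_) x⟩
  have h := translate_char I g⁻¹ χ
  rw [inv_inv] at h
  exact h

end Main

end GAlg

end

theorem proposition2p5 {k : Type u} [Field k]
    {G : Type u} [CommGroup G] [Finite G] (hG : ¬ ringChar k ∣ Nat.card G)
    {Λ : Type u} [Ring Λ] [Algebra k Λ] [Module.Finite k Λ]
    [MulSemiringAction G Λ] [SMulCommClass G k Λ]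
    (X : GAlg.Db k Λ) (I : GAlg.Invariant G X) :
    ∃ Φ : GAlg.SkewGroupAlgebra (GAlg.EndAlg I) G ≃ₐ[k]
        GAlg.EndAlg (GAlg.inducedInvariant (G := G) X),
      ∀ (χ : GAlg.CharGroup k G) (a : GAlg.SkewGroupAlgebra (GAlg.EndAlg I) G),
        Φ (χ • a) = χ • Φ a :=
  GAlg.exists_algEquiv_end I
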